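/- Let $n\ge 2$, let $q\in\mathbb{C}\setminus\{0\}$ not be a root of unity, fix a logarithm $\hbar$ of $q$ and put $q^x=e^{\hbar x}$, $[x]_q=\frac{q^x-q^{-x}}{q-q^{-1}}$ for $x\in\mathbb{C}$, and $1(q)=\{x\in\mathbb{C}: q^x=1\}$. Let $\mathfrak h\cong\mathbb{C}^n$ be the diagonal Cartan subalgebra of $\mathfrak{gl}_n$ with basis $\epsilon_1,\dots,\epsilon_n$, put $\alpha_i=\epsilon_i-\epsilon_{i+1}$ and $\langle h,\alpha_i\rangle=h_i-h_{i+1}$, and let $U_q=U_q(\mathfrak{gl}_n)$ be the unital associative $\mathbb{C}$-algebra with generators $e_i,f_i$ ($1\le i\le n-1$), $q^h$ ($h\in\mathfrak h$) and relations $q^0=1$, $q^hq^{h'}=q^{h+h'}$, $q^he_iq^{-h}=q^{\langle h,\alpha_i\rangle}e_i$, $q^hf_iq^{-h}=q^{-\langle h,\alpha_i\rangle}f_i$, $e_if_j-f_je_i=\delta_{ij}\frac{q^{\alpha_i}-q^{-\alpha_i}}{q-q^{-1}}$, $e_i^2e_j-(q+q^{-1})e_ie_je_i+e_je_i^2=0=f_i^2f_j-(q+q^{-1})f_if_jf_i+f_jf_i^2$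 for $|i-j|=1$, and $e_ie_j=e_je_i$, $f_if_j=f_jf_i$ for $|i-j|>1$. Let $\mathfrak V=\{(i,j):1\le j\le i\le n\}$. A tableau $T(L)$ is an array $L=(l_{ij})_{(i,j)\in\mathfrak V}$ of complex numbers, and $\delta^{ij}$ is the array with entry $1$ at $(i,j)$ and $0$ elsewhere. Let $\mathcal R$ be the set of the formal relations $(i,j)\ge(i-1,j')$ and $(i-1,j')>(i,j)$ for $1\le j\le i\le n$, $1\le j'\le i-1$, and $(n,i)\ge(n,j)$ for $1\le i\ne j\le n$. For $\mathcal C\subseteq\mathcal R$ let $\mathfrak V(\mathcal C)$ be the set of positions that occur in relations of $\mathcal C$; $\mathcal C$ is indecomposable if it is not a union of two nonempty subsets $\mathcal A,\mathcal B$ with $\mathfrak V(\mathcal A)\cap\mathfrak V(\mathcal B)=\emptyset$. The tableau $T(L)$ satisfies $\mathcal C$ (is a $\mathcal C$-realization) if $l_{ij}-l_{rs}\in\mathbb Z_{\ge0}+\frac{1(q)}2$ for every relation $(i,j)\ge(r,s)$ in $\mathcal C$, $l_{ij}-l_{rs}\in\mathbb Z_{>0}+\frac{1(q)}2$ for every relation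 $(i,j)>(r,s)$ in $\mathcal C$, and, for $1\le k\le n$ and $i\neq j$, $l_{ki}-l_{kj}\in\mathbb Z+\frac{1(q)}2$ only if $(k,i),(k,j)\in\mathfrak V(\mathcal D)$ for some indecomposable $\mathcal D\subseteq\mathcal C$. In this case let $\mathcal B_{\mathcal C}(T(L))$ be the set of all tableaux $T(L+z)$ satisfying $\mathcal C$, where $z$ is an integral array with zero $n$-th row, and let $V_{\mathcal C}(T(L))$ be the complex vector space with basis $\mathcal B_{\mathcal C}(T(L))$. The set $\mathcal C$ is realizable if for every tableau $T(L)$ satisfying $\mathcal C$ the Gelfand–Tsetlin formulas \begin{align*} q^{\epsilon_k}T(S)&=q^{a_k}T(S),\quad a_k=\sum_{i=1}^k s_{ki}-\sum_{i=1}^{k-1}s_{k-1,i}+k\quad(1\le k\le n),\\ e_kT(S)&=-\sum_{j=1}^k\frac{\prod_{i=1}^{k+1}[s_{k+1,i}-s_{kj}]_q}{\prod_{i\ne j}[s_{ki}-s_{kj}]_q}T(S+\delta^{kj})\quad(1\le k\le n-1),\\ f_kT(S)&=\sum_{j=1}^k\frac{\prod_{i=1}^{k-1}[s_{k-1,i}-s_{kj}]_q}{\prod_{i\ne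 j}[s_{ki}-s_{kj}]_q}T(S-\delta^{kj})\quad(1\le k\le n-1), \end{align*} have nonzero denominators for all $T(S)\in\mathcal B_{\mathcal C}(T(L))$ and are the action of the generators in some $U_q$-module structure on $V_{\mathcal C}(T(L))$, where tableaux on the right-hand sides that are not in $\mathcal B_{\mathcal C}(T(L))$ are read as $0$. A removal replaces $\mathcal C$ by the set of those relations of $\mathcal C$ that do not involve $(k,i)$, where $(k,i)\in\mathfrak V(\mathcal C)$ is such that for some tableau $T(L)$ satisfying $\mathcal C$ the tableau $T(L+m\delta^{ki})$ satisfies $\mathcal C$ for infinitely many $m\in\mathbb Z$. A set is obtained from $\mathcal C$ by the RR-method if it results from $\mathcal C$ by a finite sequence of one or more removals. **Theorem.** Let $\mathcal C_1\subseteq\mathcal R$ be realizable. If $\mathcal C_2$ is obtained from $\mathcal C_1$ by the RR-method, then $\mathcal C_2$ is realizable. -/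

import Mathlib

noncomputable section

namespace QuantumGT

/-! ### Powers of `q` and quantum integers

The parameter is `q = exp ℏ`; the choice of the logarithm `ℏ` of `q` gives a meaning to the
powers `q ^ x` with complex exponent `x`. -/

/-- `q ^ x = exp (ℏ x)`. -/
def qpow (ℏ x : ℂ) : ℂ := Complex.exp (ℏ * x)

/-- `[x]_q = (q ^ x - q ^ (-x)) / (q - q ^ (-1))`. -/
def qnum (ℏ x : ℂ) : ℂ := (qpow ℏ x - qpow ℏ (-x)) / (qpow ℏ 1 - qpow ℏ (-1))

/-- `1(q)`, the set of all complex `x` with `q ^ x = 1`. -/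
def oneQ (ℏ : ℂ) : Set ℂ := {x | qpow ℏ x = 1}

/-! ### The algebra `U_q(gl_n)` -/

/-- Indices `1, …, n`. -/
abbrev Idx (n : ℕ) : Type := ↥(Finset.Icc 1 n)

/-- Indices `1, …, n - 1` of the simple roots. -/
abbrev SimpleIdx (n : ℕ) : Type := ↥(Finset.Ico 1 n)

/-- The simple index `i` as an element of `1, …, n`. -/
def SimpleIdx.fst {n : ℕ} (i : SimpleIdx n) : Idx n :=
  ⟨i.1, Finset.mem_Icc.2 ⟨(Finset.mem_Ico.1 i.2).1, (Finset.mem_Ico.1 i.2).2.le⟩⟩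

/-- The index `i + 1`, for a simple index `i`. -/
def SimpleIdx.snd {n : ℕ} (i : SimpleIdx n) : Idx n :=
  ⟨i.1 + 1, Finset.mem_Icc.2 ⟨Nat.le_add_left 1 i.1, (Finset.mem_Ico.1 i.2).2⟩⟩

/-- The Cartan subalgebra of diagonal matrices of `gl_n`, given by the diagonal entries. -/
abbrev Cartan (n : ℕ) : Type := Idx n → ℂ

/-- `ε_k`, the `k`-th diagonal matrix unit. -/
def eps {n : ℕ} (k : Idx n) : Cartan n := Pi.single k 1

/-- `α_i = ε_i - ε_{i+1}` as an element of the Cartan subalgebra. -/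
def simpleRoot {n : ℕ} (i : SimpleIdx n) : Cartan n := eps i.fst - eps i.snd

/-- The pairing `⟨h, α_i⟩ = h_i - h_{i+1}`. -/
def pairing {n : ℕ} (h : Cartan n) (i : SimpleIdx n) : ℂ := h i.fst - h i.snd

/-- Generators `e_i`, `f_i` (`1 ≤ i ≤ n - 1`) and `q ^ h` of `U_q(gl_n)`. -/
inductive UqGen (n : ℕ) : Type
  | e (i : SimpleIdx n)
  | f (i : SimpleIdx n)
  | K (h : Cartan n)

/-- The generator `e_i` in the free algebra. -/
abbrev fE {n : ℕ} (i : SimpleIdx n) : FreeAlgebra ℂ (UqGen n) := FreeAlgebra.ι ℂ (UqGen.e i)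

/-- The generator `f_i` in the free algebra. -/
abbrev fF {n : ℕ} (i : SimpleIdx n) : FreeAlgebra ℂ (UqGen n) := FreeAlgebra.ι ℂ (UqGen.f i)

/-- The generator `q ^ h` in the free algebra. -/
abbrev fK {n : ℕ} (h : Cartan n) : FreeAlgebra ℂ (UqGen n) := FreeAlgebra.ι ℂ (UqGen.K h)

/-- The indices `i` and `j` are neighbours: `|i - j| = 1`. -/
def Neighbours {n : ℕ} (i j : SimpleIdx n) : Prop := i.1 + 1 = j.1 ∨ j.1 + 1 = i.1

/-- The indices `i` and `j` are distant: `|i - j| > 1`. -/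
def Distant {n : ℕ} (i j : SimpleIdx n) : Prop := i.1 + 1 < j.1 ∨ j.1 + 1 < i.1

/-- The defining relations of `U_q(gl_n)`. -/
inductive UqRel (n : ℕ) (ℏ : ℂ) :
    FreeAlgebra ℂ (UqGen n) → FreeAlgebra ℂ (UqGen n) → Prop
  | K_zero : UqRel n ℏ (fK 0) 1
  | K_add (h h' : Cartan n) : UqRel n ℏ (fK h * fK h') (fK (h + h'))
  | K_e (h : Cartan n) (i : SimpleIdx n) :
      UqRel n ℏ (fK h * fE i * fK (-h)) (qpow ℏ (pairing h i) • fE i)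
  | K_f (h : Cartan n) (i : SimpleIdx n) :
      UqRel n ℏ (fK h * fF i * fK (-h)) (qpow ℏ (-pairing h i) • fF i)
  | e_f_same (i : SimpleIdx n) :
      UqRel n ℏ (fE i * fF i - fF i * fE i)
        ((qpow ℏ 1 - qpow ℏ (-1))⁻¹ • (fK (simpleRoot i) - fK (-simpleRoot i)))
  | e_f_ne (i j : SimpleIdx n) (hij : i ≠ j) : UqRel n ℏ (fE i * fF j - fF j * fE i) 0
  | serre_e (i j : SimpleIdx n) (hij : Neighbours i j) :
      UqRel n ℏ
        (fE i ^ 2 * fE j - (qpow ℏ 1 + qpow ℏ (-1)) • (fE i * fE j * fE i) + fE j * fE i ^ 2) 0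
  | serre_f (i j : SimpleIdx n) (hij : Neighbours i j) :
      UqRel n ℏ
        (fF i ^ 2 * fF j - (qpow ℏ 1 + qpow ℏ (-1)) • (fF i * fF j * fF i) + fF j * fF i ^ 2) 0
  | comm_e (i j : SimpleIdx n) (hij : Distant i j) : UqRel n ℏ (fE i * fE j) (fE j * fE i)
  | comm_f (i j : SimpleIdx n) (hij : Distant i j) : UqRel n ℏ (fF i * fF j) (fF j * fF i)

/-- The quantum enveloping algebra `U_q(gl_n)`, a unital associative `ℂ`-algebra. -/
abbrev Uq (n : ℕ) (ℏ : ℂ) : Type := RingQuot (UqRel n ℏ)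

/-- The class in `U_q(gl_n)` of a generator. -/
def gen {n : ℕ} (ℏ : ℂ) (g : UqGen n) : Uq n ℏ :=
  RingQuot.mkAlgHom ℂ (UqRel n ℏ) (FreeAlgebra.ι ℂ g)

/-! ### Tableaux and sets of relations -/

/-- The set `𝔙` of positions `(i, j)` with `1 ≤ j ≤ i ≤ n`. -/
abbrev Pos (n : ℕ) : Type :=
  ↥((Finset.Icc 1 n ×ˢ Finset.Icc 1 n).filter fun p : ℕ × ℕ => p.2 ≤ p.1)

/-- The row `i` of the position `(i, j)`. -/
def Pos.row {n : ℕ} (v : Pos n) : ℕ := v.1.1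

/-- The positions in row `k`. -/
def rowSet (n k : ℕ) : Finset (Pos n) := Finset.univ.filter fun v => v.row = k

/-- A Gelfand-Tsetlin tableau `T(L)` of height `n`. -/
abbrev Tableau (n : ℕ) : Type := Pos n → ℂ

/-- The tableau `δ^v`, with entry `1` at the position `v` and `0` elsewhere. -/
def delta {n : ℕ} (v : Pos n) : Tableau n := Pi.single v 1

/-- Relations `u ≥ v` and `u > v` between positions. -/
inductive PosRel (n : ℕ) : Type
  | ge (u v : Pos n)
  | gt (u v : Pos n)

/-- The relation `r` involves the position `w`. -/
def PosRel.Involves {n : ℕ} : PosRel n → Pos n → Prop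
  | .ge u v, w => w = u ∨ w = v
  | .gt u v, w => w = u ∨ w = v

/-- The set `𝓡 = 𝓡^≥ ∪ 𝓡^> ∪ 𝓡^0` of all relations under consideration: `(i,j) ≥ (i-1,j')`,
`(i-1,j') > (i,j)`, and `(n,i) ≥ (n,j)` with `i ≠ j`. -/
def allRel (n : ℕ) : Set (PosRel n) :=
  {r | ∃ u v : Pos n, u.row = v.row + 1 ∧ r = .ge u v} ∪
  {r | ∃ u v : Pos n, v.row = u.row + 1 ∧ r = .gt u v} ∪
  {r | ∃ u v : Pos n, u.row = n ∧ v.row = n ∧ u ≠ v ∧ r = .ge u v}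

/-- `𝔙(C)`, the set of positions involved in some relation of `C`. -/
def support {n : ℕ} (C : Set (PosRel n)) : Set (Pos n) := {w | ∃ r ∈ C, r.Involves w}

/-- `C` is indecomposable: it is not the union of two disconnected (nonempty) subsets. -/
def Indecomposable {n : ℕ} (C : Set (PosRel n)) : Prop :=
  ¬ ∃ A B : Set (PosRel n), A.Nonempty ∧ B.Nonempty ∧ A ∪ B = C ∧ support A ∩ support B = ∅

/-- The positions `u` and `v` belong to the same indecomposable subset of `C`. -/
def SameIndecomposable {n : ℕ} (C : Set (PosRel n)) (u v : Pos n) : Prop :=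
  ∃ D ⊆ C, Indecomposable D ∧ u ∈ support D ∧ v ∈ support D

/-- `T(L)` satisfies a single relation: `l_u - l_v ∈ ℤ_{≥ 0} + 1(q)/2` for `u ≥ v`, and
`l_u - l_v ∈ ℤ_{> 0} + 1(q)/2` for `u > v`. -/
def SatisfiesRel {n : ℕ} (ℏ : ℂ) (L : Tableau n) : PosRel n → Prop
  | .ge u v => ∃ m : ℤ, 0 ≤ m ∧ ∃ x ∈ oneQ ℏ, L u - L v = m + x / 2
  | .gt u v => ∃ m : ℤ, 0 < m ∧ ∃ x ∈ oneQ ℏ, L u - L v = m + x / 2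

/-- `T(L)` satisfies `C`, i.e. `T(L)` is a `C`-realization: all relations of `C` hold, and two
different entries of one row differ by an element of `ℤ + 1(q)/2` only if their positions
belong to the same indecomposable subset of `C`. -/
def Satisfies {n : ℕ} (ℏ : ℂ) (C : Set (PosRel n)) (L : Tableau n) : Prop :=
  (∀ r ∈ C, SatisfiesRel ℏ L r) ∧
  ∀ u v : Pos n, u.row = v.row → u ≠ v →
    (∃ m : ℤ, ∃ x ∈ oneQ ℏ, L u - L v = m + x / 2) → SameIndecomposable C u v

/-- `𝓑_C(T(L))`: the tableaux `T(L + z)` that satisfy `C`, where `z` is an integral vector that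
vanishes in the top row. -/
def basisSet {n : ℕ} (ℏ : ℂ) (C : Set (PosRel n)) (L : Tableau n) : Set (Tableau n) :=
  {S | Satisfies ℏ C S ∧
    ∃ z : Pos n → ℤ, (∀ v, v.row = n → z v = 0) ∧ ∀ v, S v = L v + z v}

/-- `V_C(T(L))`: the complex vector space with basis `𝓑_C(T(L))`. -/
abbrev V {n : ℕ} (ℏ : ℂ) (C : Set (PosRel n)) (L : Tableau n) : Type := basisSet ℏ C L →₀ ℂ

open Classical in
/-- The tableau `T(S)` as a vector of `V_C(T(L))`; it is zero if `T(S)` is not in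
`𝓑_C(T(L))`. -/
def tab {n : ℕ} (ℏ : ℂ) (C : Set (PosRel n)) (L S : Tableau n) : V ℏ C L :=
  if h : S ∈ basisSet ℏ C L then Finsupp.single ⟨S, h⟩ 1 else 0

/-! ### The Gelfand-Tsetlin formulas -/

/-- `∏ [l_{k,i} - l_{k,j}]_q` over `i ≠ j`, where `v = (k, j)`. -/
def gtDenom {n : ℕ} (ℏ : ℂ) (S : Tableau n) (v : Pos n) : ℂ :=
  ∏ u ∈ (rowSet n v.row).erase v, qnum ℏ (S u - S v)

/-- Coefficient of `T(S + δ^v)` in `e_k T(S)`, up to sign, where `v = (k, j)`. -/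
def eCoeff {n : ℕ} (ℏ : ℂ) (S : Tableau n) (v : Pos n) : ℂ :=
  (∏ u ∈ rowSet n (v.row + 1), qnum ℏ (S u - S v)) / gtDenom ℏ S v

/-- Coefficient of `T(S - δ^v)` in `f_k T(S)`, where `v = (k, j)`; row `0` is empty. -/
def fCoeff {n : ℕ} (ℏ : ℂ) (S : Tableau n) (v : Pos n) : ℂ :=
  (∏ u ∈ rowSet n (v.row - 1), qnum ℏ (S u - S v)) / gtDenom ℏ S v

/-- `a_k = ∑ l_{k,i} - ∑ l_{k-1,i} + k`; row `0` is empty. -/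
def weight {n : ℕ} (S : Tableau n) (k : Idx n) : ℂ :=
  (∑ u ∈ rowSet n k.1, S u) - (∑ u ∈ rowSet n (k.1 - 1), S u) + (k.1 : ℂ)

/-- `C` is realizable: for every tableau `T(L)` satisfying `C`, the Gelfand-Tsetlin formulas are
meaningful on `𝓑_C(T(L))` (no denominator vanishes) and there is a `U_q(gl_n)`-module structure
on `V_C(T(L))` for which the generators act on the basis by these formulas. -/
def Realizable {n : ℕ} (ℏ : ℂ) (C : Set (PosRel n)) : Prop :=
  ∀ L : Tableau n, Satisfies ℏ C L →
    (∀ S ∈ basisSet ℏ C L, ∀ v : Pos n, v.row < n → gtDenom ℏ S v ≠ 0) ∧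
    ∃ ρ : Uq n ℏ →ₐ[ℂ] Module.End ℂ (V ℏ C L), ∀ S ∈ basisSet ℏ C L,
      (∀ k : Idx n,
        ρ (gen ℏ (.K (eps k))) (tab ℏ C L S) = qpow ℏ (weight S k) • tab ℏ C L S) ∧
      (∀ k : SimpleIdx n,
        ρ (gen ℏ (.e k)) (tab ℏ C L S) =
          -∑ v ∈ rowSet n k.1, eCoeff ℏ S v • tab ℏ C L (S + delta v)) ∧
      (∀ k : SimpleIdx n,
        ρ (gen ℏ (.f k)) (tab ℏ C L S) =
          ∑ v ∈ rowSet n k.1, fCoeff ℏ S v • tab ℏ C L (S - delta v))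

/-! ### The relations removal method -/

/-- One removal: for some position `w` of `𝔙(C)` and some tableau `T(L)` satisfying `C` such that
`T(L + m δ^w)` is a `C`-realization for infinitely many integers `m`, all relations involving
`w` are removed from `C`. -/
def RRStep {n : ℕ} (ℏ : ℂ) (C C' : Set (PosRel n)) : Prop :=
  ∃ w ∈ support C, ∃ L : Tableau n, Satisfies ℏ C L ∧
    {m : ℤ | Satisfies ℏ C (L + (m : ℂ) • delta w)}.Infinite ∧
    C' = {r ∈ C | ¬ r.Involves w}

/-- `C'` is obtained from `C` by the RR-method: by a finite sequence of (at least one)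
removals. -/
def ObtainedByRR {n : ℕ} (ℏ : ℂ) (C C' : Set (PosRel n)) : Prop :=
  Relation.TransGen (RRStep ℏ) C C'

end QuantumGT

end

noncomputable section

namespace QuantumGT

/-! ### Laurent polynomials and rational functions in the powers `q ^ t_p` -/

section QFunctions

variable {ι : Type} {ℏ : ℂ}

/-- The algebra of Laurent polynomials in the functions `t ↦ q ^ t_p`. -/
def qLaurent (ι : Type) (ℏ : ℂ) : Subalgebra ℂ ((ι → ℂ) → ℂ) :=
  Algebra.adjoin ℂ (Set.range (fun (p : ι) (t : ι → ℂ) => qpow ℏ (t p)) ∪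
    Set.range (fun (p : ι) (t : ι → ℂ) => qpow ℏ (-t p)))

theorem qpow_add (ℏ x y : ℂ) : qpow ℏ (x + y) = qpow ℏ x * qpow ℏ y := by
  simp [qpow, mul_add, Complex.exp_add]

theorem qpow_zero (ℏ : ℂ) : qpow ℏ 0 = 1 := by simp [qpow]

theorem qpow_ne_zero (ℏ x : ℂ) : qpow ℏ x ≠ 0 := Complex.exp_ne_zero _

theorem qpow_mul_neg (ℏ x : ℂ) : qpow ℏ x * qpow ℏ (-x) = 1 := by
  rw [← qpow_add, add_neg_cancel, qpow_zero]

/-- Negative powers are cleared by a power of the product of all `q ^ t_p`, so that vanishing can be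
tested on polynomials. -/
theorem exists_polynomial_of_mem_qLaurent [Fintype ι] {f : (ι → ℂ) → ℂ} (hf : f ∈ qLaurent ι ℏ) :
    ∃ (P : MvPolynomial ι ℂ) (N : ℕ), ∀ t : ι → ℂ,
      f t * (∏ p, qpow ℏ (t p)) ^ N = MvPolynomial.eval (fun p => qpow ℏ (t p)) P := by
  classical
  induction hf using Algebra.adjoin_induction with
  | mem f hf =>
    rcases hf with ⟨p, rfl⟩ | ⟨p, rfl⟩
    · exact ⟨MvPolynomial.X p, 0, fun t => by simp⟩
    · refine ⟨∏ r ∈ Finset.univ.erase p, MvPolynomial.X r, 1, fun t => ?_⟩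
      rw [pow_one, ← Finset.mul_prod_erase _ _ (Finset.mem_univ p), ← mul_assoc,
        mul_comm (qpow ℏ (-t p)), qpow_mul_neg]
      simp [map_prod]
  | algebraMap r => exact ⟨MvPolynomial.C r, 0, fun t => by simp⟩
  | add f g _ _ hf hg =>
    obtain ⟨P, N, hP⟩ := hf
    obtain ⟨Q, M, hQ⟩ := hg
    refine ⟨P * (∏ p, MvPolynomial.X p) ^ M + Q * (∏ p, MvPolynomial.X p) ^ N, N + M,
      fun t => ?_⟩
    simp only [map_add, map_mul, map_pow, map_prod, MvPolynomial.eval_X, ← hP, ← hQ,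
      Pi.add_apply]
    ring
  | mul f g _ _ hf hg =>
    obtain ⟨P, N, hP⟩ := hf
    obtain ⟨Q, M, hQ⟩ := hg
    refine ⟨P * Q, N + M, fun t => ?_⟩
    simp only [map_mul, ← hP, ← hQ, Pi.mul_apply]
    ring

/-- A Laurent polynomial in the `q ^ t_p` that vanishes on a product of sets on each of which
`q ^ x` takes infinitely many values is zero. -/
theorem eq_zero_of_mem_qLaurent [Fintype ι] {f : (ι → ℂ) → ℂ} (hf : f ∈ qLaurent ι ℏ) (T : ι → Set ℂ)
    (hT : ∀ p, (qpow ℏ '' T p).Infinite) (h : ∀ t, (∀ p, t p ∈ T p) → f t = 0)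
    (t : ι → ℂ) : f t = 0 := by
  obtain ⟨P, N, hP⟩ := exists_polynomial_of_mem_qLaurent hf
  have hP0 : P = 0 := by
    refine MvPolynomial.funext_set (fun p => qpow ℏ '' T p) hT fun x hx => ?_
    choose y hy hyx using fun p => hx p (Set.mem_univ p)
    have hxy : x = fun p => qpow ℏ (y p) := funext fun p => (hyx p).symm
    rw [hxy, ← hP y, h y hy, zero_mul, map_zero]
  have h0 := hP t
  rw [hP0, map_zero] at h0
  exact (mul_eq_zero.1 h0).resolve_right
    (pow_ne_zero _ (Finset.prod_ne_zero_iff.2 fun p _ => qpow_ne_zero _ _))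

/-- `t ↦ q ^ {x(t)}` and its inverse are Laurent polynomials. -/
def QExponent (ℏ : ℂ) (x : (ι → ℂ) → ℂ) : Prop :=
  (fun t => qpow ℏ (x t)) ∈ qLaurent ι ℏ ∧ (fun t => qpow ℏ (-x t)) ∈ qLaurent ι ℏ

theorem QExponent.coord (p : ι) : QExponent ℏ fun t : ι → ℂ => t p :=
  ⟨Algebra.subset_adjoin (.inl ⟨p, rfl⟩), Algebra.subset_adjoin (.inr ⟨p, rfl⟩)⟩

theorem QExponent.const (c : ℂ) : QExponent ℏ fun _ : ι → ℂ => c :=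
  ⟨(qLaurent ι ℏ).algebraMap_mem (qpow ℏ c), (qLaurent ι ℏ).algebraMap_mem (qpow ℏ (-c))⟩

theorem QExponent.add {x y : (ι → ℂ) → ℂ} (hx : QExponent ℏ x) (hy : QExponent ℏ y) :
    QExponent ℏ fun t => x t + y t := by
  refine ⟨?_, ?_⟩
  · simp only [qpow_add]; exact mul_mem hx.1 hy.1
  · simp only [neg_add, qpow_add]; exact mul_mem hx.2 hy.2

theorem QExponent.neg {x : (ι → ℂ) → ℂ} (hx : QExponent ℏ x) : QExponent ℏ fun t => -x t :=
  ⟨hx.2, by simpa only [neg_neg] using hx.1⟩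

theorem QExponent.sub {x y : (ι → ℂ) → ℂ} (hx : QExponent ℏ x) (hy : QExponent ℏ y) :
    QExponent ℏ fun t => x t - y t := by
  simpa only [sub_eq_add_neg] using hx.add hy.neg

theorem QExponent.sum {κ : Type} (s : Finset κ) {x : κ → (ι → ℂ) → ℂ}
    (hx : ∀ i ∈ s, QExponent ℏ (x i)) : QExponent ℏ fun t => ∑ i ∈ s, x i t := by
  classical
  induction s using Finset.induction_on with
  | empty => simpa using QExponent.const (ι := ι) (ℏ := ℏ) 0
  | insert i s hi ih =>
    simp only [Finset.sum_insert hi]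
    exact (hx i (Finset.mem_insert_self i s)).add
      (ih fun j hj => hx j (Finset.mem_insert_of_mem hj))

/-- On `G`, the function `f` is a quotient of Laurent polynomials in the `q ^ t_p` whose
denominator has no zero in `G`. -/
def QRational (ℏ : ℂ) (G : Set (ι → ℂ)) (f : (ι → ℂ) → ℂ) : Prop :=
  ∃ a ∈ qLaurent ι ℏ, ∃ b ∈ qLaurent ι ℏ, ∀ t ∈ G, b t ≠ 0 ∧ f t = a t / b t

namespace QRational

variable {G : Set (ι → ℂ)}

theorem of_mem {f : (ι → ℂ) → ℂ} (hf : f ∈ qLaurent ι ℏ) : QRational ℏ G f :=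
  ⟨f, hf, 1, one_mem _, fun t _ => by simp⟩

theorem const (c : ℂ) : QRational ℏ G fun _ => c :=
  of_mem ((qLaurent ι ℏ).algebraMap_mem c)

theorem add {f g : (ι → ℂ) → ℂ} (hf : QRational ℏ G f) (hg : QRational ℏ G g) :
    QRational ℏ G fun t => f t + g t := by
  obtain ⟨a, ha, b, hb, h⟩ := hf
  obtain ⟨c, hc, d, hd, h'⟩ := hg
  refine ⟨a * d + b * c, add_mem (mul_mem ha hd) (mul_mem hb hc), b * d, mul_mem hb hd,
    fun t ht => ⟨mul_ne_zero (h t ht).1 (h' t ht).1, ?_⟩⟩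
  simp only [(h t ht).2, (h' t ht).2]
  exact div_add_div _ _ (h t ht).1 (h' t ht).1

theorem mul {f g : (ι → ℂ) → ℂ} (hf : QRational ℏ G f) (hg : QRational ℏ G g) :
    QRational ℏ G fun t => f t * g t := by
  obtain ⟨a, ha, b, hb, h⟩ := hf
  obtain ⟨c, hc, d, hd, h'⟩ := hg
  refine ⟨a * c, mul_mem ha hc, b * d, mul_mem hb hd,
    fun t ht => ⟨mul_ne_zero (h t ht).1 (h' t ht).1, ?_⟩⟩
  simp only [(h t ht).2, (h' t ht).2]
  exact div_mul_div_comm _ _ _ _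

theorem inv {f : (ι → ℂ) → ℂ} (hf : QRational ℏ G f) (h0 : ∀ t ∈ G, f t ≠ 0) :
    QRational ℏ G fun t => (f t)⁻¹ := by
  obtain ⟨a, ha, b, hb, h⟩ := hf
  refine ⟨b, hb, a, ha, fun t ht => ⟨fun hat => h0 t ht ?_, ?_⟩⟩
  · rw [(h t ht).2, hat, zero_div]
  · simp only [(h t ht).2, inv_div]

theorem div {f g : (ι → ℂ) → ℂ} (hf : QRational ℏ G f) (hg : QRational ℏ G g)
    (h0 : ∀ t ∈ G, g t ≠ 0) : QRational ℏ G fun t => f t / g t := by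
  simpa only [div_eq_mul_inv] using hf.mul (hg.inv h0)

theorem neg {f : (ι → ℂ) → ℂ} (hf : QRational ℏ G f) : QRational ℏ G fun t => -f t := by
  simpa using (const (-1)).mul hf

theorem sub {f g : (ι → ℂ) → ℂ} (hf : QRational ℏ G f) (hg : QRational ℏ G g) :
    QRational ℏ G fun t => f t - g t := by
  simpa only [sub_eq_add_neg] using hf.add hg.neg

theorem sum {κ : Type} (s : Finset κ) {f : κ → (ι → ℂ) → ℂ}
    (hf : ∀ i ∈ s, QRational ℏ G (f i)) : QRational ℏ G fun t => ∑ i ∈ s, f i t := by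
  classical
  induction s using Finset.induction_on with
  | empty => simpa using const (ℏ := ℏ) (G := G) 0
  | insert i s hi ih =>
    simp only [Finset.sum_insert hi]
    exact (hf i (Finset.mem_insert_self i s)).add
      (ih fun j hj => hf j (Finset.mem_insert_of_mem hj))

theorem prod {κ : Type} (s : Finset κ) {f : κ → (ι → ℂ) → ℂ}
    (hf : ∀ i ∈ s, QRational ℏ G (f i)) : QRational ℏ G fun t => ∏ i ∈ s, f i t := by
  classical
  induction s using Finset.induction_on with
  | empty => simpa using const (ℏ := ℏ) (G := G) 1
  | insert i s hi ih =>
    simp only [Finset.prod_insert hi]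
    exact (hf i (Finset.mem_insert_self i s)).mul
      (ih fun j hj => hf j (Finset.mem_insert_of_mem hj))

/-- The factor `(q - q⁻¹)⁻¹` enters as a constant, so it imposes no condition on `G`. -/
theorem qnum {x : (ι → ℂ) → ℂ} (hx : QExponent ℏ x) :
    QRational ℏ G fun t => QuantumGT.qnum ℏ (x t) := by
  simpa only [QuantumGT.qnum, div_eq_mul_inv] using
    ((of_mem hx.1).sub (of_mem hx.2)).mul (const _)

/-- A rational function that vanishes on a product of sets contained in `G`, on each of which
`q ^ x` takes infinitely many values, vanishes on `G`. -/
theorem eq_zero [Fintype ι] {f : (ι → ℂ) → ℂ} (hf : QRational ℏ G f) (T : ι → Set ℂ)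
    (hT : ∀ p, (qpow ℏ '' T p).Infinite) (hTG : ∀ t, (∀ p, t p ∈ T p) → t ∈ G)
    (h : ∀ t, (∀ p, t p ∈ T p) → f t = 0) {t : ι → ℂ} (ht : t ∈ G) : f t = 0 := by
  obtain ⟨a, ha, b, hb, hab⟩ := hf
  have ha0 : ∀ t, a t = 0 := by
    refine eq_zero_of_mem_qLaurent ha T hT fun t ht => ?_
    have := h t ht
    rw [(hab t (hTG t ht)).2] at this
    exact (div_eq_zero_iff.1 this).resolve_right (hab t (hTG t ht)).1
  rw [(hab t ht).2, ha0, zero_div]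

end QRational

end QFunctions

/-! ### The Gelfand-Tsetlin formulas in integral coordinates around a tableau -/

section LocalOperators

variable {n : ℕ} {ℏ : ℂ}

/-- The tableau `T(S + z)` for an integral array `z`. -/
def shift (S : Tableau n) (z : Pos n → ℤ) : Tableau n := fun v => S v + z v

theorem shift_injective (S : Tableau n) : Function.Injective (shift S) := fun z z' h => by
  funext v
  have := congrFun h v
  simpa [shift] using this

theorem shift_zero (S : Tableau n) : shift S 0 = S := by
  funext v; simp [shift]

theorem shift_shift (S : Tableau n) (z z' : Pos n → ℤ) :
    shift (shift S z) z' = shift S (z + z') := by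
  funext v; simp [shift, add_assoc]

/-- Names of the generators `e_k` (as `(true, k)`) and `f_k` (as `(false, k)`). -/
abbrev Letter (n : ℕ) : Type := Bool × SimpleIdx n

/-- The array `δ^v` for a raising and `-δ^v` for a lowering operator. -/
def unitShift (b : Bool) (v : Pos n) : Pos n → ℤ := Pi.single v (if b then 1 else -1)

theorem abs_unitShift_le (b : Bool) (v u : Pos n) : |unitShift b v u| ≤ 1 := by
  unfold unitShift
  rcases eq_or_ne u v with rfl | h
  · cases b <;> simp
  · simp [h]

theorem shift_unitShift_true (S : Tableau n) (v : Pos n) :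
    shift S (unitShift true v) = S + delta v := by
  funext u
  rcases eq_or_ne u v with rfl | h
  · simp [shift, unitShift, delta]
  · simp [shift, unitShift, delta, h]

theorem shift_unitShift_false (S : Tableau n) (v : Pos n) :
    shift S (unitShift false v) = S - delta v := by
  funext u
  rcases eq_or_ne u v with rfl | h
  · simp [shift, unitShift, delta, sub_eq_add_neg]
  · simp [shift, unitShift, delta, h]

/-- The coefficient in the Gelfand-Tsetlin formula for `e_k` or `f_k`, sign included. -/
def stepCoeff (ℏ : ℂ) (b : Bool) (S : Tableau n) (v : Pos n) : ℂ :=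
  if b then -eCoeff ℏ S v else fCoeff ℏ S v

open Classical in
/-- The operator of `e_k` or `f_k` on functions of the coordinate array `z` of `T(S + z)`;
tableaux that do not satisfy `P` are read as zero. -/
def localOp (ℏ : ℂ) (S : Tableau n) (P : (Pos n → ℤ) → Prop) (l : Letter n) :
    Module.End ℂ ((Pos n → ℤ) → ℂ) where
  toFun x z := if P z then ∑ v ∈ rowSet n l.2.1,
    if P (z - unitShift l.1 v) then
      stepCoeff ℏ l.1 (shift S (z - unitShift l.1 v)) v * x (z - unitShift l.1 v) else 0 else 0
  map_add' x y := by
    funext z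
    by_cases h : P z
    · simp only [h, if_true, Pi.add_apply, ← Finset.sum_add_distrib]
      refine Finset.sum_congr rfl fun v _ => ?_
      split_ifs <;> ring
    · simp [h]
  map_smul' c x := by
    funext z
    by_cases h : P z
    · simp only [h, if_true, Pi.smul_apply, smul_eq_mul, RingHom.id_apply, Finset.mul_sum]
      refine Finset.sum_congr rfl fun v _ => ?_
      split_ifs <;> ring
    · simp [h]

open Classical in
theorem localOp_apply (S : Tableau n) (P : (Pos n → ℤ) → Prop) (l : Letter n)
    (x : (Pos n → ℤ) → ℂ) (z : Pos n → ℤ) :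
    localOp ℏ S P l x z = if P z then ∑ v ∈ rowSet n l.2.1,
      if P (z - unitShift l.1 v) then
        stepCoeff ℏ l.1 (shift S (z - unitShift l.1 v)) v * x (z - unitShift l.1 v)
      else 0 else 0 := rfl

/-- The operator of `e_k` or `f_k` on `V_C(T(L))`, given by the Gelfand-Tsetlin formulas. -/
def gtOp (ℏ : ℂ) (C : Set (PosRel n)) (L : Tableau n) (l : Letter n) :
    Module.End ℂ (V ℏ C L) :=
  Finsupp.linearCombination ℂ fun s : basisSet ℏ C L =>
    ∑ v ∈ rowSet n l.2.1, stepCoeff ℏ l.1 s.1 v • tab ℏ C L (shift s.1 (unitShift l.1 v))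

theorem tab_of_mem {C : Set (PosRel n)} {L S : Tableau n} (h : S ∈ basisSet ℏ C L) :
    tab ℏ C L S = Finsupp.single ⟨S, h⟩ 1 := dif_pos h

theorem gtOp_tab {C : Set (PosRel n)} {L S : Tableau n} (h : S ∈ basisSet ℏ C L) (l : Letter n) :
    gtOp ℏ C L l (tab ℏ C L S) =
      ∑ v ∈ rowSet n l.2.1, stepCoeff ℏ l.1 S v • tab ℏ C L (shift S (unitShift l.1 v)) := by
  rw [tab_of_mem h, gtOp, Finsupp.linearCombination_single, one_smul]

/-- Linear maps on `V_C(T(L))` are determined by their values on tableaux. -/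
theorem V_hom_ext {C : Set (PosRel n)} {L : Tableau n} {W : Type*} [AddCommMonoid W] [Module ℂ W]
    {φ ψ : V ℏ C L →ₗ[ℂ] W} (h : ∀ S ∈ basisSet ℏ C L, φ (tab ℏ C L S) = ψ (tab ℏ C L S)) :
    φ = ψ := by
  refine Finsupp.lhom_ext' fun s => LinearMap.ext_ring ?_
  have := h s.1 s.2
  rwa [tab_of_mem s.2] at this

open Classical in
/-- The coordinates of a vector of `V_C(T(L))`, tableaux being written as `T(S + z)`. -/
def coords (ℏ : ℂ) (C : Set (PosRel n)) (L S : Tableau n) :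
    V ℏ C L →ₗ[ℂ] ((Pos n → ℤ) → ℂ) where
  toFun x z := if h : shift S z ∈ basisSet ℏ C L then x ⟨_, h⟩ else 0
  map_add' x y := by
    funext z
    by_cases h : shift S z ∈ basisSet ℏ C L <;> simp [h]
  map_smul' c x := by
    funext z
    by_cases h : shift S z ∈ basisSet ℏ C L <;> simp [h]

open Classical in
theorem coords_apply (C : Set (PosRel n)) (L S : Tableau n) (x : V ℏ C L) (z : Pos n → ℤ) :
    coords ℏ C L S x z = if h : shift S z ∈ basisSet ℏ C L then x ⟨_, h⟩ else 0 := rfl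

theorem exists_shift_eq {C : Set (PosRel n)} {L S S' : Tableau n} (hS : S ∈ basisSet ℏ C L)
    (hS' : S' ∈ basisSet ℏ C L) :
    ∃ z : Pos n → ℤ, (∀ v, v.row = n → z v = 0) ∧ S' = shift S z := by
  obtain ⟨-, z, hz, hzS⟩ := hS
  obtain ⟨-, z', hz', hzS'⟩ := hS'
  refine ⟨z' - z, fun v hv => by simp [hz v hv, hz' v hv], ?_⟩
  funext v
  simp only [shift, hzS, hzS', Pi.sub_apply, Int.cast_sub]
  ring

theorem coords_injective {C : Set (PosRel n)} {L S : Tableau n} (hS : S ∈ basisSet ℏ C L) :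
    Function.Injective (coords ℏ C L S) := by
  intro x y hxy
  ext ⟨s, hs⟩
  obtain ⟨z, -, rfl⟩ := exists_shift_eq hS hs
  have := congrFun hxy z
  simpa only [coords_apply, dif_pos hs] using this

open Classical in
theorem coords_tab (C : Set (PosRel n)) (L S : Tableau n) (z z' : Pos n → ℤ) :
    coords ℏ C L S (tab ℏ C L (shift S z)) z' =
      if shift S z ∈ basisSet ℏ C L ∧ z' = z then 1 else 0 := by
  rw [coords_apply]
  by_cases h : shift S z ∈ basisSet ℏ C L
  · rw [tab_of_mem h]
    by_cases hz : z' = z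
    · subst hz
      simp [h]
    · have hne : shift S z ≠ shift S z' := fun e => hz (shift_injective S e).symm
      simp [hz, hne]
  · simp [h, tab]

theorem coords_tab_self {C : Set (PosRel n)} {L S : Tableau n} (hS : S ∈ basisSet ℏ C L) :
    coords ℏ C L S (tab ℏ C L S) = Pi.single 0 1 := by
  classical
  funext z
  have := coords_tab (ℏ := ℏ) C L S 0 z
  rw [shift_zero] at this
  rw [this, Pi.single_apply]
  simp [hS]

/-- This transports the operators to functions on integral arrays, a space that depends neither on
`C` nor on the tableau. There `T(S)` and its deformations can be compared. -/
theorem coords_gtOp {C : Set (PosRel n)} {L S : Tableau n} (hS : S ∈ basisSet ℏ C L)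
    (l : Letter n) (x : V ℏ C L) :
    coords ℏ C L S (gtOp ℏ C L l x) =
      localOp ℏ S (fun z => shift S z ∈ basisSet ℏ C L) l (coords ℏ C L S x) := by
  classical
  suffices h : coords ℏ C L S ∘ₗ gtOp ℏ C L l =
      localOp ℏ S (fun z => shift S z ∈ basisSet ℏ C L) l ∘ₗ coords ℏ C L S from
    LinearMap.congr_fun h x
  refine V_hom_ext fun S' hS' => ?_
  obtain ⟨z, -, rfl⟩ := exists_shift_eq hS hS'
  funext z'
  rw [LinearMap.comp_apply, LinearMap.comp_apply, gtOp_tab hS', localOp_apply, map_sum,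
    Finset.sum_apply]
  by_cases hz' : shift S z' ∈ basisSet ℏ C L
  · rw [if_pos hz']
    refine Finset.sum_congr rfl fun v _ => ?_
    rw [map_smul, Pi.smul_apply, shift_shift, coords_tab, coords_tab, smul_eq_mul]
    by_cases h : z' - unitShift l.1 v = z
    · have h' : z' = z + unitShift l.1 v := by rw [← h, sub_add_cancel]
      rw [← h', if_pos ⟨hz', rfl⟩, h, if_pos hS', if_pos ⟨hS', rfl⟩]
    · have h' : ¬ z' = z + unitShift l.1 v := fun e => h (by rw [e, add_sub_cancel_right])
      simp [h, h']
  · rw [if_neg hz']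
    refine Finset.sum_eq_zero fun v _ => ?_
    rw [map_smul, Pi.smul_apply, shift_shift, coords_tab, if_neg, smul_zero]
    rintro ⟨h, rfl⟩
    exact hz' h

/-- A linear combination of words, evaluated in an algebra. -/
def evalWords {κ A : Type*} [Ring A] [Algebra ℂ A] (o : κ → A) (M : List (ℂ × List κ)) : A :=
  (M.map fun p => p.1 • (p.2.map o).prod).sum

theorem intertwine_word {κ X Y : Type*} [AddCommGroup X] [Module ℂ X] [AddCommGroup Y]
    [Module ℂ Y] {φ : X →ₗ[ℂ] Y} {o : κ → Module.End ℂ X} {o' : κ → Module.End ℂ Y}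
    (h : ∀ l x, φ (o l x) = o' l (φ x)) (w : List κ) (x : X) :
    φ ((w.map o).prod x) = (w.map o').prod (φ x) := by
  induction w with
  | nil => simp
  | cons l w ih => simp [h, ih]

theorem intertwine_evalWords {κ X Y : Type*} [AddCommGroup X] [Module ℂ X] [AddCommGroup Y]
    [Module ℂ Y] {φ : X →ₗ[ℂ] Y} {o : κ → Module.End ℂ X} {o' : κ → Module.End ℂ Y}
    (h : ∀ l x, φ (o l x) = o' l (φ x)) (M : List (ℂ × List κ)) (x : X) :
    φ (evalWords o M x) = evalWords o' M (φ x) := by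
  induction M with
  | nil => simp [evalWords]
  | cons p M ih =>
    simp only [evalWords, List.map_cons, List.sum_cons, LinearMap.add_apply, map_add,
      LinearMap.smul_apply, map_smul, intertwine_word h] at ih ⊢
    rw [ih]

/-- A relation among the `gtOp` holds on `T(S)` if and only if it holds in coordinates. -/
theorem evalWords_gtOp_iff {C : Set (PosRel n)} {L S : Tableau n} (hS : S ∈ basisSet ℏ C L)
    (M : List (ℂ × List (Letter n))) (κ : ℂ) :
    evalWords (gtOp ℏ C L) M (tab ℏ C L S) = κ • tab ℏ C L S ↔
      evalWords (localOp ℏ S fun z => shift S z ∈ basisSet ℏ C L) M (Pi.single 0 1) =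
        κ • Pi.single 0 1 := by
  rw [← (coords_injective hS).eq_iff, intertwine_evalWords (coords_gtOp hS), map_smul,
    coords_tab_self hS]

/-- One letter changes one entry by `±1`, so supports grow by at most one. Values of the predicate
farther out are only ever multiplied by zero. -/
theorem localOp_congr (S : Tableau n) {P P' : (Pos n → ℤ) → Prop} {N : ℤ} {x : (Pos n → ℤ) → ℂ}
    (hP : ∀ z : Pos n → ℤ, (∀ v, |z v| ≤ N + 1) → (P z ↔ P' z))
    (hx : ∀ z, x z ≠ 0 → ∀ v, |z v| ≤ N) (l : Letter n) :
    localOp ℏ S P l x = localOp ℏ S P' l x ∧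
      ∀ z, localOp ℏ S P l x z ≠ 0 → ∀ v, |z v| ≤ N + 1 := by
  classical
  have hball : ∀ z v, x (z - unitShift l.1 v) ≠ 0 → ∀ u, |z u| ≤ N + 1 := by
    intro z v h u
    have h1 := hx _ h u
    have h2 := abs_unitShift_le l.1 v u
    rw [Pi.sub_apply] at h1
    rw [abs_le] at *
    omega
  refine ⟨?_, ?_⟩
  · funext z
    simp only [localOp_apply]
    by_cases hz : ∀ v, |z v| ≤ N + 1
    · rw [if_congr (hP z hz) ?_ rfl]
      refine Finset.sum_congr rfl fun v _ => ?_
      by_cases h0 : x (z - unitShift l.1 v) = 0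
      · simp [h0]
      · exact if_congr (hP _ fun u => (hx _ h0 u).trans (by omega)) rfl rfl
    · have h0 : ∀ v, x (z - unitShift l.1 v) = 0 := fun v => by
        by_contra h
        exact hz (hball z v h)
      simp [h0]
  · intro z hz
    by_contra hb
    have h0 : ∀ v, x (z - unitShift l.1 v) = 0 := fun v => by
      by_contra h
      exact hb (hball z v h)
    exact hz (by simp [localOp_apply, h0])

/-- Words of length at most `N` at `T(S)` only depend on the tableaux at distance at
most `N`. -/
theorem localOp_word_congr (S : Tableau n) {P P' : (Pos n → ℤ) → Prop} {N : ℕ}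
    (hP : ∀ z : Pos n → ℤ, (∀ v, |z v| ≤ N) → (P z ↔ P' z)) (w : List (Letter n))
    (hw : w.length ≤ N) :
    (w.map (localOp ℏ S P)).prod (Pi.single 0 1) =
        (w.map (localOp ℏ S P')).prod (Pi.single 0 1) ∧
      ∀ z, (w.map (localOp ℏ S P)).prod (Pi.single 0 1) z ≠ 0 → ∀ v, |z v| ≤ w.length := by
  induction w with
  | nil =>
    refine ⟨rfl, fun z hz v => ?_⟩
    have : z = 0 := by
      by_contra h
      exact hz (by simp [h])
    simp [this]
  | cons l w ih =>
    rw [List.length_cons] at hw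
    obtain ⟨h1, h2⟩ := ih (by omega)
    simp only [List.map_cons, List.prod_cons, Module.End.mul_apply, ← h1]
    have h3 := localOp_congr (ℏ := ℏ) S (N := w.length)
      (fun z hz => hP z fun v => (hz v).trans (by exact_mod_cast hw)) h2 l
    simpa using h3

theorem evalWords_localOp_congr (S : Tableau n) {P P' : (Pos n → ℤ) → Prop} {N : ℕ}
    (hP : ∀ z : Pos n → ℤ, (∀ v, |z v| ≤ N) → (P z ↔ P' z)) (M : List (ℂ × List (Letter n)))
    (hM : ∀ p ∈ M, p.2.length ≤ N) :
    evalWords (localOp ℏ S P) M (Pi.single 0 1) = evalWords (localOp ℏ S P') M (Pi.single 0 1) := by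
  induction M with
  | nil => rfl
  | cons p M ih =>
    have h1 := ih fun p' hp' => hM p' (List.mem_cons_of_mem _ hp')
    have h2 := (localOp_word_congr (ℏ := ℏ) S hP p.2 (hM p List.mem_cons_self)).1
    simp only [evalWords, List.map_cons, List.sum_cons, LinearMap.add_apply,
      LinearMap.smul_apply] at h1 ⊢
    rw [h1, h2]

/-! ### Rational dependence of the operators on parameters of the tableau -/

variable {ι : Type} {G : Set (ι → ℂ)} {S : (ι → ℂ) → Tableau n}

theorem QRational.gtDenom (hS : ∀ v, QExponent ℏ fun t => S t v) (v : Pos n) :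
    QRational ℏ G fun t => QuantumGT.gtDenom ℏ (S t) v :=
  QRational.prod _ fun u _ => QRational.qnum ((hS u).sub (hS v))

theorem QRational.stepCoeff (hS : ∀ v, QExponent ℏ fun t => S t v) (b : Bool) (v : Pos n)
    (h0 : ∀ t ∈ G, QuantumGT.gtDenom ℏ (S t) v ≠ 0) :
    QRational ℏ G fun t => QuantumGT.stepCoeff ℏ b (S t) v := by
  cases b
  · exact (QRational.prod _ fun u _ => QRational.qnum ((hS u).sub (hS v))).div
      (QRational.gtDenom hS v) h0
  · exact ((QRational.prod _ fun u _ => QRational.qnum ((hS u).sub (hS v))).div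
      (QRational.gtDenom hS v) h0).neg

/-- The predicate `P` does not depend on `t`, so the same terms occur for every `t`. Coefficients
are only taken at arrays satisfying `P`, where `h0` excludes poles. -/
theorem QRational.localOp (hS : ∀ v, QExponent ℏ fun t => S t v) {P : (Pos n → ℤ) → Prop}
    (h0 : ∀ t ∈ G, ∀ z, P z → ∀ v : Pos n, v.row < n → QuantumGT.gtDenom ℏ (shift (S t) z) v ≠ 0)
    (l : Letter n) {x : (ι → ℂ) → (Pos n → ℤ) → ℂ} (hx : ∀ z, QRational ℏ G fun t => x t z)
    (z : Pos n → ℤ) : QRational ℏ G fun t => QuantumGT.localOp ℏ (S t) P l (x t) z := by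
  classical
  simp only [localOp_apply]
  by_cases hz : P z
  · simp only [if_pos hz]
    refine QRational.sum _ fun v hv => ?_
    by_cases hz' : P (z - unitShift l.1 v)
    · simp only [if_pos hz']
      have hvn : v.row < n := by
        rw [rowSet, Finset.mem_filter] at hv
        rw [hv.2]
        exact (Finset.mem_Ico.1 l.2.2).2
      exact (QRational.stepCoeff (S := fun t => shift (S t) (z - unitShift l.1 v))
        (fun u => (hS u).add (QExponent.const _)) _ _ fun t ht => h0 t ht _ hz' v hvn).mul (hx _)
    · simp only [if_neg hz']
      exact QRational.const 0
  · simp only [if_neg hz]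
    exact QRational.const 0

theorem QRational.evalWords (hS : ∀ v, QExponent ℏ fun t => S t v) {P : (Pos n → ℤ) → Prop}
    (h0 : ∀ t ∈ G, ∀ z, P z → ∀ v : Pos n, v.row < n → QuantumGT.gtDenom ℏ (shift (S t) z) v ≠ 0)
    (M : List (ℂ × List (Letter n))) (z : Pos n → ℤ) :
    QRational ℏ G fun t =>
      QuantumGT.evalWords (QuantumGT.localOp ℏ (S t) P) M (Pi.single 0 1) z := by
  have hword : ∀ (w : List (Letter n)) (z : Pos n → ℤ), QRational ℏ G fun t =>
      (w.map (QuantumGT.localOp ℏ (S t) P)).prod (Pi.single 0 1) z := by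
    intro w
    induction w with
    | nil => exact fun z => QRational.const _
    | cons l w ih => exact fun z => QRational.localOp hS h0 l ih z
  induction M with
  | nil => exact QRational.const 0
  | cons p M ih => exact ((QRational.const p.1).mul (hword p.2 z)).add ih

end LocalOperators

/-! ### Connected components of a set of relations -/

section Components

variable {n : ℕ}

/-- The left-hand side of a relation. -/
def PosRel.left : PosRel n → Pos n
  | .ge u _ => u
  | .gt u _ => u

/-- The right-hand side of a relation. -/
def PosRel.right : PosRel n → Pos n
  | .ge _ v => v
  | .gt _ v => v

theorem PosRel.involves_iff (r : PosRel n) (w : Pos n) :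
    r.Involves w ↔ w = r.left ∨ w = r.right := by
  cases r <;> rfl

theorem PosRel.involves_left (r : PosRel n) : r.Involves r.left :=
  (r.involves_iff _).2 (.inl rfl)

theorem PosRel.involves_right (r : PosRel n) : r.Involves r.right :=
  (r.involves_iff _).2 (.inr rfl)

theorem left_ne_right_of_mem_allRel {r : PosRel n} (hr : r ∈ allRel n) : r.left ≠ r.right := by
  rcases hr with (⟨u, v, h, rfl⟩ | ⟨u, v, h, rfl⟩) | ⟨u, v, -, -, h, rfl⟩
  · rintro e
    change u = v at e
    subst e
    omega
  · rintro e
    change u = v at e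
    subst e
    omega
  · exact h

/-- Connectedness of positions through relations of `C`, as an equivalence relation. -/
def connSetoid (C : Set (PosRel n)) : Setoid (Pos n) :=
  Relation.EqvGen.setoid fun u v => ∃ r ∈ C, r.Involves u ∧ r.Involves v

/-- The positions `u` and `v` are connected through relations of `C`. -/
def Conn (C : Set (PosRel n)) (u v : Pos n) : Prop := (connSetoid C).r u v

theorem Conn.refl (C : Set (PosRel n)) (u : Pos n) : Conn C u u := (connSetoid C).refl' u

theorem Conn.symm {C : Set (PosRel n)} {u v : Pos n} (h : Conn C u v) : Conn C v u :=
  (connSetoid C).symm' h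

theorem Conn.trans {C : Set (PosRel n)} {u v w : Pos n} (h : Conn C u v) (h' : Conn C v w) :
    Conn C u w := (connSetoid C).trans' h h'

theorem conn_of_involves {C : Set (PosRel n)} {r : PosRel n} (hr : r ∈ C) {u v : Pos n}
    (hu : r.Involves u) (hv : r.Involves v) : Conn C u v :=
  Relation.EqvGen.rel _ _ ⟨r, hr, hu, hv⟩

theorem Conn.induction {C : Set (PosRel n)} {p : Pos n → Pos n → Prop} (hrefl : ∀ u, p u u)
    (hsymm : ∀ u v, p u v → p v u) (htrans : ∀ u v w, p u v → p v w → p u w)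
    (hrel : ∀ r ∈ C, ∀ u v, r.Involves u → r.Involves v → p u v) {u v : Pos n}
    (h : Conn C u v) : p u v := by
  change Relation.EqvGen _ u v at h
  induction h with
  | rel u v h =>
    obtain ⟨r, hr, hu, hv⟩ := h
    exact hrel r hr u v hu hv
  | refl u => exact hrefl u
  | symm u v _ ih => exact hsymm u v ih
  | trans u v w _ _ ih ih' => exact htrans u v w ih ih'

theorem Conn.mono {C C' : Set (PosRel n)} (hC : C ⊆ C') {u v : Pos n} (h : Conn C u v) :
    Conn C' u v :=
  h.induction (Conn.refl C') (fun _ _ => Conn.symm) (fun _ _ _ => Conn.trans)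
    fun _ hr _ _ => conn_of_involves (hC hr)

/-- A position in no relation is its own component; this isolates `w` after the removal. -/
theorem Conn.eq_or_mem_support {C : Set (PosRel n)} {u v : Pos n} (h : Conn C u v) :
    u = v ∨ u ∈ support C ∧ v ∈ support C :=
  h.induction (p := fun u v => u = v ∨ u ∈ support C ∧ v ∈ support C) (fun _ => .inl rfl)
    (fun u v h => h.elim (fun e => .inl e.symm) fun e => .inr e.symm)
    (fun u v w h h' => by
      rcases h with rfl | h
      · exact h'
      · rcases h' with rfl | h'
        · exact .inr h
        · exact .inr ⟨h.1, h'.2⟩)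
    fun r hr u v hu hv => .inr ⟨⟨r, hr, hu⟩, ⟨r, hr, hv⟩⟩

/-- Otherwise `D` splits into the relations that meet the component of `u` and the remaining ones.
-/
theorem SameIndecomposable.conn {C : Set (PosRel n)} {u v : Pos n}
    (h : SameIndecomposable C u v) : Conn C u v := by
  obtain ⟨D, hDC, hD, ⟨r, hr, hru⟩, ⟨r', hr', hrv⟩⟩ := h
  by_contra hne
  refine hD ⟨{s ∈ D | ∃ x, s.Involves x ∧ Conn C u x}, {s ∈ D | ¬ ∃ x, s.Involves x ∧ Conn C u x},
    ⟨r, hr, u, hru, Conn.refl C u⟩, ⟨r', hr', ?_⟩, ?_, ?_⟩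
  · rintro ⟨x, hx, hux⟩
    exact hne (hux.trans (conn_of_involves (hDC hr') hx hrv))
  · ext s
    exact ⟨fun h => h.elim And.left And.left, fun h => (em _).imp (⟨h, ·⟩) (⟨h, ·⟩)⟩
  · refine Set.eq_empty_iff_forall_notMem.2 ?_
    rintro x ⟨⟨s, ⟨hs, y, hy, huy⟩, hsx⟩, ⟨s', ⟨hs', hn⟩, hsx'⟩⟩
    exact hn ⟨x, hsx', huy.trans (conn_of_involves (hDC hs) hy hsx)⟩

/-- The indecomposable set is formed by all relations that meet the component of `u`. The case `u =
v` is excluded because a position outside the support is connected to itself. -/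
theorem Conn.sameIndecomposable {C : Set (PosRel n)} {u v : Pos n} (h : Conn C u v)
    (hne : u ≠ v) : SameIndecomposable C u v := by
  obtain ⟨⟨r, hr, hru⟩, ⟨r', hr', hrv⟩⟩ := h.eq_or_mem_support.resolve_left hne
  refine ⟨{s ∈ C | ∃ x, s.Involves x ∧ Conn C u x}, fun s hs => hs.1, ?_,
    ⟨r, ⟨hr, u, hru, Conn.refl C u⟩, hru⟩, ⟨r', ⟨hr', v, hrv, h⟩, hrv⟩⟩
  rintro ⟨A, B, ⟨a, ha⟩, ⟨b, hb⟩, hAB, hdisj⟩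
  have hnot : ∀ x, x ∈ support A → x ∉ support B := fun x hxA hxB => by
    have : x ∈ support A ∩ support B := ⟨hxA, hxB⟩
    rw [hdisj] at this
    exact this
  have hmem : ∀ s, s ∈ A ∪ B → s ∈ C ∧ ∃ x, s.Involves x ∧ Conn C u x := fun s hs => by
    rw [hAB] at hs
    exact hs
  have hA : ∀ x, x ∈ support A → Conn C u x := by
    rintro x ⟨s, hs, hsx⟩
    obtain ⟨hsC, y, hy, huy⟩ := hmem s (.inl hs)
    exact huy.trans (conn_of_involves hsC hy hsx)
  -- The support of one part of a decomposition is a union of components. Being nonempty, it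
  -- contains the component of `u`, which leaves nothing for the other part.
  have key : ∀ x y, Conn C x y → (x ∈ support A ↔ y ∈ support A) := by
    intro x y hxy
    refine hxy.induction (p := fun x y => x ∈ support A ↔ y ∈ support A) (fun _ => Iff.rfl)
      (fun _ _ => Iff.symm) (fun _ _ _ => Iff.trans) ?_
    have one : ∀ s ∈ C, ∀ x y, s.Involves x → s.Involves y → x ∈ support A → y ∈ support A := by
      intro s hs x y hx hy hxA
      have hsD : s ∈ A ∪ B := by
        rw [hAB]
        exact ⟨hs, x, hx, hA x hxA⟩
      rcases hsD with hsA | hsB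
      · exact ⟨s, hsA, hy⟩
      · exact (hnot x hxA ⟨s, hsB, hx⟩).elim
    exact fun s hs x y hx hy => ⟨one s hs x y hx hy, one s hs y x hy hx⟩
  have huA : u ∈ support A := (key u a.left (hA _ ⟨a, ha, a.involves_left⟩)).2
    ⟨a, ha, a.involves_left⟩
  obtain ⟨-, y, hy, huy⟩ := hmem b (.inr hb)
  exact hnot y ((key u y huy).1 huA) ⟨b, hb, hy⟩

/-- A representative of the connected component of a position. -/
def rep (C : Set (PosRel n)) (u : Pos n) : Pos n :=
  (Quotient.mk (connSetoid C) u).out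

theorem conn_rep (C : Set (PosRel n)) (u : Pos n) : Conn C u (rep C u) :=
  (connSetoid C).symm' (Quotient.mk_out (s := connSetoid C) u)

theorem Conn.rep_eq {C : Set (PosRel n)} {u v : Pos n} (h : Conn C u v) : rep C u = rep C v :=
  congrArg Quotient.out (Quotient.sound (s := connSetoid C) h)

end Components

/-! ### The group `ℤ + 1(q)/2` -/

section Lattice

variable {n : ℕ} {ℏ : ℂ}

/-- The subgroup `1(q)` of `ℂ`. -/
def oneQGroup (ℏ : ℂ) : AddSubgroup ℂ where
  carrier := oneQ ℏ
  zero_mem' := qpow_zero ℏ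
  add_mem' {x y} hx hy := by
    change qpow ℏ (x + y) = 1
    rw [qpow_add, show qpow ℏ x = 1 from hx, show qpow ℏ y = 1 from hy, one_mul]
  neg_mem' {x} hx := by
    have := qpow_mul_neg ℏ x
    rwa [show qpow ℏ x = 1 from hx, one_mul] at this

/-- The subgroup `ℤ + 1(q)/2` of `ℂ`. -/
def qLattice (ℏ : ℂ) : AddSubgroup ℂ where
  carrier := {y | ∃ m : ℤ, ∃ x ∈ oneQ ℏ, y = m + x / 2}
  zero_mem' := ⟨0, 0, (oneQGroup ℏ).zero_mem, by simp⟩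
  add_mem' := by
    rintro _ _ ⟨m, x, hx, rfl⟩ ⟨m', x', hx', rfl⟩
    exact ⟨m + m', x + x', (oneQGroup ℏ).add_mem hx hx', by push_cast; ring⟩
  neg_mem' := by
    rintro _ ⟨m, x, hx, rfl⟩
    exact ⟨-m, -x, (oneQGroup ℏ).neg_mem hx, by push_cast; ring⟩

theorem mem_qLattice {y : ℂ} : y ∈ qLattice ℏ ↔ ∃ m : ℤ, ∃ x ∈ oneQ ℏ, y = m + x / 2 := Iff.rfl

theorem intCast_mem_qLattice (m : ℤ) : (m : ℂ) ∈ qLattice ℏ :=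
  ⟨m, 0, (oneQGroup ℏ).zero_mem, by simp⟩

theorem half_mem_qLattice {x : ℂ} (hx : x ∈ oneQ ℏ) : x / 2 ∈ qLattice ℏ :=
  ⟨0, x, hx, by simp⟩

/-- Twice the difference of the integers lies in `1(q)`, which contains no nonzero integer. So
elements of `ℤ + 1(q)/2` have a well-defined integral part. -/
theorem int_eq_of_add_half_eq (hq : ∀ m : ℤ, qpow ℏ m = 1 → m = 0) {m m' : ℤ} {x x' : ℂ}
    (hx : x ∈ oneQ ℏ) (hx' : x' ∈ oneQ ℏ) (h : (m : ℂ) + x / 2 = m' + x' / 2) : m = m' := by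
  have h1 : ((2 * (m - m') : ℤ) : ℂ) = x' - x := by
    push_cast
    linear_combination 2 * h
  have h2 : qpow ℏ ((2 * (m - m') : ℤ) : ℂ) = 1 := by
    rw [h1]
    exact (oneQGroup ℏ).sub_mem hx' hx
  have := hq _ h2
  omega

/-- Vanishing means `q ^ y = q ^ (-y)`, that is `2y ∈ 1(q)`. This is the origin of the halves in `ℤ
+ 1(q)/2`. -/
theorem mem_qLattice_of_qnum_eq_zero (hq : ∀ m : ℤ, qpow ℏ m = 1 → m = 0) {y : ℂ}
    (h : qnum ℏ y = 0) : y ∈ qLattice ℏ := by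
  have hd : qpow ℏ 1 - qpow ℏ (-1) ≠ 0 := by
    intro h0
    have h2 : qpow ℏ ((2 : ℤ) : ℂ) = 1 := by
      rw [show ((2 : ℤ) : ℂ) = 1 + 1 by norm_num, qpow_add]
      nth_rewrite 2 [sub_eq_zero.1 h0]
      exact qpow_mul_neg ℏ 1
    exact absurd (hq 2 h2) (by norm_num)
  have hy : qpow ℏ y = qpow ℏ (-y) :=
    sub_eq_zero.1 ((div_eq_zero_iff.1 h).resolve_right hd)
  refine ⟨0, 2 * y, ?_, by push_cast; ring⟩
  change qpow ℏ (2 * y) = 1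
  rw [two_mul, qpow_add]
  nth_rewrite 2 [hy]
  exact qpow_mul_neg ℏ y

theorem countable_oneQ (hℏ : ℏ ≠ 0) : (oneQ ℏ).Countable := by
  refine (Set.countable_range fun k : ℤ => (k : ℂ) * (2 * Real.pi * Complex.I) / ℏ).mono ?_
  intro x hx
  obtain ⟨k, hk⟩ := Complex.exp_eq_one_iff.1 (show Complex.exp (ℏ * x) = 1 from hx)
  exact ⟨k, by simp only [← hk]; field_simp⟩

theorem countable_qLattice (hℏ : ℏ ≠ 0) : (qLattice ℏ : Set ℂ).Countable := by
  refine ((Set.countable_univ (α := ℤ)).prod (countable_oneQ hℏ) |>.image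
    fun p => (p.1 : ℂ) + p.2 / 2).mono ?_
  rintro _ ⟨m, x, hx, rfl⟩
  exact ⟨(m, x), ⟨trivial, hx⟩, rfl⟩

/-- There is a class modulo `ℤ + 1(q)/2` that contains no entry of a given tableau. -/
theorem exists_generic (hℏ : ℏ ≠ 0) (S : Tableau n) : ∃ c : ℂ, ∀ v, c - S v ∉ qLattice ℏ := by
  have hc : (⋃ v : Pos n, (fun y => S v + y) '' (qLattice ℏ : Set ℂ)).Countable :=
    Set.countable_iUnion fun v => (countable_qLattice hℏ).image _
  obtain ⟨c, hc⟩ : ∃ c, c ∉ ⋃ v : Pos n, (fun y => S v + y) '' (qLattice ℏ : Set ℂ) := by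
    by_contra! h
    exact not_countable_complex (hc.mono fun x _ => h x)
  refine ⟨c, fun v hv => hc (Set.mem_iUnion.2 ⟨v, _, hv, ?_⟩)⟩
  simp

/-- Different terms of the progression have different powers because `q` is not a root of unity. -/
theorem infinite_qpow_image (hq : ∀ m : ℤ, qpow ℏ m = 1 → m = 0) (a : ℂ) {σ : ℤ} (hσ : σ ≠ 0)
    (M : ℕ) : (qpow ℏ '' {y | ∃ m : ℕ, M ≤ m ∧ y = a + (σ * m : ℤ)}).Infinite := by
  refine Set.infinite_of_injective_forall_mem (f := fun k : ℕ => qpow ℏ (a + (σ * (M + k : ℕ) : ℤ)))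
    (fun k k' h => ?_) fun k => ⟨_, ⟨M + k, by omega, rfl⟩, rfl⟩
  have h1 : qpow ℏ ((σ * (k - k') : ℤ) : ℂ) = 1 := by
    have h2 : ((σ * (k - k') : ℤ) : ℂ) =
        a + (σ * (M + k : ℕ) : ℤ) + -(a + (σ * (M + k' : ℕ) : ℤ)) := by
      push_cast; ring
    rw [h2, qpow_add]
    simp only at h
    rw [h, qpow_mul_neg]
  have := (mul_eq_zero.1 (hq _ h1)).resolve_left hσ
  omega

theorem SatisfiesRel.exists_nonneg {L : Tableau n} {r : PosRel n} (h : SatisfiesRel ℏ L r) :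
    ∃ m : ℤ, 0 ≤ m ∧ ∃ x ∈ oneQ ℏ, L r.left - L r.right = m + x / 2 := by
  cases r with
  | ge u v => exact h
  | gt u v =>
    obtain ⟨m, hm, h⟩ := h
    exact ⟨m, hm.le, h⟩

theorem satisfiesRel_of_pos {L : Tableau n} {r : PosRel n} {m : ℤ} (hm : 0 < m) {x : ℂ}
    (hx : x ∈ oneQ ℏ) (h : L r.left - L r.right = m + x / 2) : SatisfiesRel ℏ L r := by
  cases r with
  | ge u v => exact ⟨m, hm.le, x, hx, h⟩
  | gt u v => exact ⟨m, hm, x, hx, h⟩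

theorem satisfiesRel_congr {L L' : Tableau n} {r : PosRel n}
    (h : L r.left - L r.right = L' r.left - L' r.right) :
    SatisfiesRel ℏ L r ↔ SatisfiesRel ℏ L' r := by
  cases r with
  | ge u v =>
    change L u - L v = L' u - L' v at h
    simp only [SatisfiesRel, h]
  | gt u v =>
    change L u - L v = L' u - L' v at h
    simp only [SatisfiesRel, h]

theorem Conn.sub_mem_qLattice {C : Set (PosRel n)} {L : Tableau n}
    (hL : ∀ r ∈ C, SatisfiesRel ℏ L r) {u v : Pos n} (h : Conn C u v) : L u - L v ∈ qLattice ℏ := by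
  refine h.induction (p := fun u v => L u - L v ∈ qLattice ℏ) (fun u => by simp [zero_mem])
    (fun u v h => by simpa using neg_mem h) (fun u v w h h' => by simpa using add_mem h h') ?_
  intro r hr u v hu hv
  obtain ⟨m, -, hm⟩ := (hL r hr).exists_nonneg
  have hlr : L r.left - L r.right ∈ qLattice ℏ := ⟨m, hm⟩
  rcases (r.involves_iff u).1 hu with rfl | rfl <;> rcases (r.involves_iff v).1 hv with rfl | rfl
  · simp [zero_mem]
  · exact hlr
  · simpa using neg_mem hlr
  · simp [zero_mem]

/-- Replaces indecomposable subsets by connected components, with which the rest of the proof works.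
-/
theorem satisfies_iff {C : Set (PosRel n)} {L : Tableau n} :
    Satisfies ℏ C L ↔ (∀ r ∈ C, SatisfiesRel ℏ L r) ∧
      ∀ u v : Pos n, u.row = v.row → u ≠ v → L u - L v ∈ qLattice ℏ → Conn C u v :=
  and_congr_right fun _ => ⟨fun h u v hr hne hm => (h u v hr hne hm).conn,
    fun h u v hr hne hm => (h u v hr hne hm).sameIndecomposable hne⟩

theorem shift_sub_mem_qLattice {L : Tableau n} (z : Pos n → ℤ) (u v : Pos n) :
    shift L z u - shift L z v ∈ qLattice ℏ ↔ L u - L v ∈ qLattice ℏ := by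
  have : shift L z u - shift L z v = L u - L v + ((z u - z v : ℤ) : ℂ) := by
    simp only [shift]; push_cast; ring
  rw [this]
  exact (qLattice ℏ).add_mem_cancel_right (intCast_mem_qLattice _)

theorem shift_mem_basisSet_iff {C : Set (PosRel n)} {L : Tableau n} (z : Pos n → ℤ) :
    shift L z ∈ basisSet ℏ C L ↔ Satisfies ℏ C (shift L z) ∧ ∀ v, v.row = n → z v = 0 := by
  refine and_congr_right fun _ => ⟨?_, fun h => ⟨z, h, fun v => rfl⟩⟩
  rintro ⟨z', hz', h⟩ v hv
  have := h v
  simp only [shift, add_right_inj, Int.cast_inj] at this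
  rw [this, hz' v hv]

/-- The set `𝓑_C(T(L))` does not depend on the choice of the tableau `T(L)` in it. -/
theorem basisSet_eq {C : Set (PosRel n)} {L S : Tableau n} (hS : S ∈ basisSet ℏ C L) :
    basisSet ℏ C L = basisSet ℏ C S := by
  obtain ⟨-, z, hz, hSz⟩ := hS
  ext S'
  refine and_congr_right fun _ => ⟨?_, ?_⟩
  · rintro ⟨z', hz', h⟩
    exact ⟨z' - z, fun v hv => by simp [hz v hv, hz' v hv], fun v => by
      rw [h, hSz]; push_cast [Pi.sub_apply]; ring⟩
  · rintro ⟨z', hz', h⟩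
    exact ⟨z' + z, fun v hv => by simp [hz v hv, hz' v hv], fun v => by
      rw [h, hSz]; push_cast [Pi.add_apply]; ring⟩

theorem self_mem_basisSet {C : Set (PosRel n)} {L : Tableau n} (hL : Satisfies ℏ C L) :
    L ∈ basisSet ℏ C L := ⟨hL, 0, fun _ _ => rfl, fun v => by simp⟩

/-- A position that can be moved infinitely far is on the same side of all its relations. -/
theorem one_sided_of_infinite (hq : ∀ m : ℤ, qpow ℏ m = 1 → m = 0) {C : Set (PosRel n)}
    (hC : C ⊆ allRel n) {w : Pos n} {L : Tableau n} (hL : Satisfies ℏ C L)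
    (hinf : {m : ℤ | Satisfies ℏ C (L + (m : ℂ) • delta w)}.Infinite) :
    (∀ r ∈ C, r.Involves w → r.left = w ∧ r.right ≠ w) ∨
      (∀ r ∈ C, r.Involves w → r.left ≠ w ∧ r.right = w) := by
  by_contra! h
  obtain ⟨⟨r, hr, hrw, hr1⟩, ⟨s, hs, hsw, hs1⟩⟩ := h
  have hrne := left_ne_right_of_mem_allRel (hC hr)
  have hsne := left_ne_right_of_mem_allRel (hC hs)
  have hr2 : r.right = w ∧ r.left ≠ w := by
    rcases (r.involves_iff w).1 hrw with e | e
    · exact (hrne (e.symm.trans (hr1 e.symm).symm)).elim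
    · exact ⟨e.symm, fun e' => hrne (e'.trans e)⟩
  have hs2 : s.left = w ∧ s.right ≠ w := by
    rcases (s.involves_iff w).1 hsw with e | e
    · exact ⟨e.symm, fun e' => hsne (e.symm.trans e'.symm)⟩
    · by_contra hcon
      exact hs1 (fun e' => hsne (e'.trans e)) e.symm
  obtain ⟨a, -, x, hx, ha⟩ := (hL.1 r hr).exists_nonneg
  obtain ⟨b, -, y, hy, hb⟩ := (hL.1 s hs).exists_nonneg
  -- Moving `w` by `m` turns the integral parts `a` and `b` of the two relations into `a - m` and `b
  -- + m`, which must stay nonnegative.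
  refine hinf ((Set.finite_Icc (-b) a).subset fun m hm => ?_)
  obtain ⟨a', ha0, x', hx', ha'⟩ := (hm.1 r hr).exists_nonneg
  obtain ⟨b', hb0, y', hy', hb'⟩ := (hm.1 s hs).exists_nonneg
  simp only [Pi.add_apply, Pi.smul_apply, delta, smul_eq_mul, hr2.1, hs2.1, Pi.single_eq_same,
    Pi.single_eq_of_ne hr2.2, Pi.single_eq_of_ne hs2.2, mul_one, mul_zero, add_zero] at ha' hb'
  rw [hr2.1] at ha
  rw [hs2.1] at hb
  have e1 : a' = a - m := int_eq_of_add_half_eq hq hx' hx (by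
    push_cast; linear_combination ha - ha')
  have e2 : b' = b + m := int_eq_of_add_half_eq hq hy' hy (by
    push_cast; linear_combination hb - hb')
  exact Set.mem_Icc.2 (by omega)

end Lattice

/-! ### Deformation of a tableau -/

section Deformation

variable {n : ℕ} {ℏ : ℂ}

open Classical in
/-- The components of `C₂` that are contained in the component of `w` in `C₁` are translated
independently of each other, according to the parameters `t`. -/
def deform (C₁ C₂ : Set (PosRel n)) (w : Pos n) (S : Tableau n) (t : Pos n → ℂ) : Tableau n :=
  fun u => S u + if Conn C₁ u w then t (rep C₂ u) else 0

theorem deform_zero (C₁ C₂ : Set (PosRel n)) (w : Pos n) (S : Tableau n) :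
    deform C₁ C₂ w S 0 = S := by
  funext u; simp [deform]

theorem deform_qExponent (C₁ C₂ : Set (PosRel n)) (w : Pos n) (S : Tableau n) (u : Pos n) :
    QExponent ℏ fun t => deform C₁ C₂ w S t u := by
  unfold deform
  by_cases h : Conn C₁ u w
  · simpa only [if_pos h] using (QExponent.const _).add (QExponent.coord (rep C₂ u))
  · simpa only [if_neg h] using (QExponent.const _).add (QExponent.const 0)

/-- A `C₂`-component lies inside one `C₁`-component and has one representative, so it moves rigidly
or not at all. -/
theorem deform_sub {C₁ C₂ : Set (PosRel n)} (hC : C₂ ⊆ C₁) (w : Pos n) (S : Tableau n)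
    (t : Pos n → ℂ) {u v : Pos n} (h : Conn C₂ u v) :
    deform C₁ C₂ w S t u - deform C₁ C₂ w S t v = S u - S v := by
  have h1 : Conn C₁ u w ↔ Conn C₁ v w :=
    ⟨fun e => (h.mono hC).symm.trans e, fun e => (h.mono hC).trans e⟩
  by_cases hv : Conn C₁ v w
  · simp [deform, h1.2 hv, hv, h.rep_eq]
  · simp [deform, mt h1.1 hv, hv]

/-- For all deformations `T(S')` of `T(S)` with parameters in a product of large sets, the
tableaux of `𝓑_{C₂}(T(S))` at distance at most `N` from `T(S)` correspond to the tableaux of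
`𝓑_{C₁}(T(S'))` at distance at most `N` from `T(S')`. -/
theorem exists_deform (hℏ : ℏ ≠ 0) (hq : ∀ m : ℤ, qpow ℏ m = 1 → m = 0)
    {C₁ C₂ : Set (PosRel n)} {w : Pos n} (hC₂ : C₂ = {r ∈ C₁ | ¬ r.Involves w})
    (hw : (∀ r ∈ C₁, r.Involves w → r.left = w ∧ r.right ≠ w) ∨
      (∀ r ∈ C₁, r.Involves w → r.left ≠ w ∧ r.right = w))
    {S : Tableau n} (hS : Satisfies ℏ C₂ S) (N : ℕ) :
    ∃ T : Pos n → Set ℂ, (∀ p, (qpow ℏ '' T p).Infinite) ∧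
      ∀ t : Pos n → ℂ, (∀ p, t p ∈ T p) → ∀ z : Pos n → ℤ, (∀ v, |z v| ≤ N) →
        (shift (deform C₁ C₂ w S t) z ∈ basisSet ℏ C₁ (deform C₁ C₂ w S t) ↔
          shift S z ∈ basisSet ℏ C₂ S) := by
  classical
  have hsub : C₂ ⊆ C₁ := by
    rw [hC₂]
    exact Set.sep_subset _ _
  have hiso : ∀ u, Conn C₂ u w → u = w := fun u h => by
    refine h.eq_or_mem_support.resolve_right ?_
    rintro ⟨-, r, hr, hrw⟩
    rw [hC₂] at hr
    exact hr.2 hrw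
  have hrepw : rep C₂ w = w := hiso _ (conn_rep C₂ w).symm
  rw [satisfies_iff] at hS
  -- All moved components are placed in the class of `c`, away from the entries that stay. Here `d u
  -- + x u / 2` is the position of `u` relative to its representative.
  obtain ⟨c, hc⟩ := exists_generic hℏ S
  choose d x hx hd using fun u => mem_qLattice.1 ((conn_rep C₂ u).sub_mem_qLattice hS.1)
  obtain ⟨σ, hσ⟩ : ∃ σ : ℤ, (σ = 1 ∧ ∀ r ∈ C₁, r.Involves w → r.left = w ∧ r.right ≠ w) ∨
      (σ = -1 ∧ ∀ r ∈ C₁, r.Involves w → r.left ≠ w ∧ r.right = w) :=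
    hw.elim (fun h => ⟨1, .inl ⟨rfl, h⟩⟩) fun h => ⟨-1, .inr ⟨rfl, h⟩⟩
  -- The margin must absorb a change of at most `N` in each of two entries and the offset `d u`
  -- inside a component.
  let M : ℕ := N + 1 + ∑ u, (d u).natAbs
  have hM : ∀ u, N + 1 + (d u).natAbs ≤ M := fun u =>
    Nat.add_le_add_left (Finset.single_le_sum (f := fun u => (d u).natAbs)
      (fun _ _ => Nat.zero_le _) (Finset.mem_univ u)) _
  let s : Pos n → ℤ := fun p => if p = w then σ else -σ
  have hs : ∀ p, s p ≠ 0 := fun p => by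
    have : σ ≠ 0 := by rcases hσ with h | h <;> simp [h.1]
    by_cases hp : p = w <;> simp [s, hp, this]
  -- The parameter carries the representative `p` from `S p` to `c ± m` with `m ≥ M`: in the
  -- direction `σ` for `w`, in the opposite direction for the other components.
  refine ⟨fun p => {y | ∃ m : ℕ, M ≤ m ∧ y = c - S p + (s p * m : ℤ)},
    fun p => infinite_qpow_image hq _ (hs p) M, fun t ht z hz => ?_⟩
  choose m hm hmt using ht
  have hval : ∀ u, Conn C₁ u w → deform C₁ C₂ w S t u =
      c + ((d u + s (rep C₂ u) * m (rep C₂ u) : ℤ) : ℂ) + x u / 2 := fun u hu => by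
    simp only [deform, if_pos hu, hmt]
    push_cast
    linear_combination hd u
  have hvalw : deform C₁ C₂ w S t w = c + ((σ * m w : ℤ) : ℂ) := by
    simp only [deform, if_pos (Conn.refl C₁ w), hmt, hrepw, s, if_true]
    ring
  have hconn_iff : ∀ r ∈ C₂, (SatisfiesRel ℏ (shift (deform C₁ C₂ w S t) z) r ↔
      SatisfiesRel ℏ (shift S z) r) := fun r hr => by
    refine satisfiesRel_congr ?_
    have := deform_sub hsub w S t (conn_of_involves hr r.involves_left r.involves_right)
    simp only [shift]
    linear_combination this
  rw [shift_mem_basisSet_iff, shift_mem_basisSet_iff]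
  refine and_congr_left fun _ => ?_
  rw [satisfies_iff, satisfies_iff]
  refine ⟨fun h => ⟨fun r hr => (hconn_iff r hr).1 (h.1 r (hsub hr)), fun u v hr hne hm => ?_⟩,
    fun h => ⟨fun r hr => ?_, fun u v hr hne hm => ?_⟩⟩
  -- Integral shifts preserve classes modulo `ℤ + 1(q)/2`, so this condition is already known for
  -- `S`.
  · exact hS.2 u v hr hne ((shift_sub_mem_qLattice z u v).1 hm)
  · by_cases hrw : r.Involves w
    · have hpos : ∀ u, u ≠ w → Conn C₁ u w → ∃ k : ℤ, 0 < k ∧ ∃ y ∈ oneQ ℏ,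
          (σ : ℂ) * (shift (deform C₁ C₂ w S t) z w - shift (deform C₁ C₂ w S t) z u) =
            k + y / 2 := by
        intro u hu hcu
        have hrep : rep C₂ u ≠ w := fun e => hu (hiso u (by
          have := conn_rep C₂ u
          rwa [e] at this))
        have hdu := hM u
        have h1 := hm w
        have h2 := hm (rep C₂ u)
        have h3 := abs_le.1 (hz u)
        have h4 := abs_le.1 (hz w)
        have h5 : σ * σ = 1 := by rcases hσ with h | h <;> simp [h.1]
        have h5' : (σ : ℂ) * σ = 1 := by exact_mod_cast h5
        -- This integral part is at least `2M - 2N - |d u|`, hence positive: it suffices for both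
        -- `≥` and `>`.
        refine ⟨m w + m (rep C₂ u) + σ * (z w - z u - d u), ?_, -(σ : ℂ) * x u, ?_, ?_⟩
        · rcases hσ with h | h <;> rw [h.1] <;> omega
        · rcases hσ with h | h <;> rw [h.1]
          · rw [Int.cast_one, neg_one_mul]
            exact (oneQGroup ℏ).neg_mem (hx u)
          · simpa using hx u
        · simp only [shift, hvalw, hval u hcu, s, if_neg hrep]
          push_cast
          linear_combination (m w + m (rep C₂ u) : ℂ) * h5'
      have hcl := conn_of_involves hr r.involves_left hrw
      have hcr := conn_of_involves hr r.involves_right hrw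
      rcases hσ with ⟨h1, h2⟩ | ⟨h1, h2⟩
      · obtain ⟨hl, hr'⟩ := h2 r hr hrw
        obtain ⟨k, hk, y, hy, e⟩ := hpos r.right hr' hcr
        refine satisfiesRel_of_pos hk hy ?_
        rw [← e, h1, hl]
        simp
      · obtain ⟨hl, hr'⟩ := h2 r hr hrw
        obtain ⟨k, hk, y, hy, e⟩ := hpos r.left hl hcl
        refine satisfiesRel_of_pos hk hy ?_
        rw [← e, h1, hr']
        simp
    · have hr2 : r ∈ C₂ := by
        rw [hC₂]
        exact ⟨hr, hrw⟩
      exact (hconn_iff r hr2).2 (h.1 r hr2)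
  · rw [shift_sub_mem_qLattice] at hm
    -- A moved entry lies in the class of `c`, which was chosen to miss every entry of `S`.
    have hmixed : ∀ u v, Conn C₁ u w → ¬ Conn C₁ v w →
        deform C₁ C₂ w S t u - deform C₁ C₂ w S t v ∉ qLattice ℏ := by
      intro u v hu hv hmem
      rw [hval u hu, show deform C₁ C₂ w S t v = S v by simp [deform, hv]] at hmem
      refine hc v ?_
      have := sub_mem (sub_mem hmem (half_mem_qLattice (hx u)))
        (intCast_mem_qLattice (d u + s (rep C₂ u) * m (rep C₂ u)))
      convert this using 1
      ring
    by_cases hu : Conn C₁ u w <;> by_cases hv : Conn C₁ v w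
    · exact hu.trans hv.symm
    · exact (hmixed u v hu hv hm).elim
    · exact (hmixed v u hv hu (by simpa using neg_mem hm)).elim
    · refine (hS.2 u v hr hne ?_).mono hsub
      simpa [deform, hu, hv] using hm

end Deformation

/-! ### Realizability in terms of relations among the Gelfand-Tsetlin operators -/

section Realizability

variable {n : ℕ} {ℏ : ℂ}

/-- The commutator of two letters. -/
def commWords (l l' : Letter n) : List (ℂ × List (Letter n)) :=
  [(1, [l, l']), (-1, [l', l])]

/-- The left-hand side of the quantum Serre relation. -/
def serreWords (ℏ : ℂ) (l l' : Letter n) : List (ℂ × List (Letter n)) :=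
  [(1, [l, l, l']), (-(qpow ℏ 1 + qpow ℏ (-1)), [l, l', l]), (1, [l', l, l])]

theorem evalWords_commWords {A : Type*} [Ring A] [Algebra ℂ A] (o : Letter n → A)
    (l l' : Letter n) : evalWords o (commWords l l') = o l * o l' - o l' * o l := by
  simp [evalWords, commWords, sub_eq_add_neg]

theorem evalWords_serreWords {A : Type*} [Ring A] [Algebra ℂ A] (o : Letter n → A)
    (l l' : Letter n) : evalWords o (serreWords ℏ l l') =
      o l ^ 2 * o l' - (qpow ℏ 1 + qpow ℏ (-1)) • (o l * o l' * o l) + o l' * o l ^ 2 := by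
  simp only [evalWords, serreWords, List.map_cons, List.map_nil, List.prod_cons, List.prod_nil,
    List.sum_cons, List.sum_nil, one_smul, neg_smul, mul_one, add_zero, pow_two, mul_assoc,
    sub_eq_add_neg, add_assoc]

/-- The eigenvalue of `(q ^ α_i - q ^ (-α_i)) / (q - q ^ (-1))` on `T(S)`. -/
def cartanValue (ℏ : ℂ) (i : SimpleIdx n) (S : Tableau n) : ℂ :=
  qnum ℏ (weight S i.fst - weight S i.snd)

/-- The relations of `U_q(gl_n)` among the operators of the `e_k` and `f_k` on `V_C(T(L))`. -/
structure GTRelations (ℏ : ℂ) (C : Set (PosRel n)) (L : Tableau n) : Prop where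
  e_f_same (i : SimpleIdx n) (S : Tableau n) (hS : S ∈ basisSet ℏ C L) :
    evalWords (gtOp ℏ C L) (commWords (true, i) (false, i)) (tab ℏ C L S) =
      cartanValue ℏ i S • tab ℏ C L S
  e_f_ne (i j : SimpleIdx n) (hij : i ≠ j) (S : Tableau n) (hS : S ∈ basisSet ℏ C L) :
    evalWords (gtOp ℏ C L) (commWords (true, i) (false, j)) (tab ℏ C L S) =
      (0 : ℂ) • tab ℏ C L S
  serre (b : Bool) (i j : SimpleIdx n) (hij : Neighbours i j) (S : Tableau n)
    (hS : S ∈ basisSet ℏ C L) :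
    evalWords (gtOp ℏ C L) (serreWords ℏ (b, i) (b, j)) (tab ℏ C L S) = (0 : ℂ) • tab ℏ C L S
  comm (b : Bool) (i j : SimpleIdx n) (hij : Distant i j) (S : Tableau n)
    (hS : S ∈ basisSet ℏ C L) :
    evalWords (gtOp ℏ C L) (commWords (b, i) (b, j)) (tab ℏ C L S) = (0 : ℂ) • tab ℏ C L S

theorem gtOp_tab_true {C : Set (PosRel n)} {L S : Tableau n} (hS : S ∈ basisSet ℏ C L)
    (k : SimpleIdx n) : gtOp ℏ C L (true, k) (tab ℏ C L S) =
      -∑ v ∈ rowSet n k.1, eCoeff ℏ S v • tab ℏ C L (S + delta v) := by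
  simp only [gtOp_tab hS, stepCoeff, if_true, shift_unitShift_true, neg_smul,
    Finset.sum_neg_distrib]

theorem gtOp_tab_false {C : Set (PosRel n)} {L S : Tableau n} (hS : S ∈ basisSet ℏ C L)
    (k : SimpleIdx n) : gtOp ℏ C L (false, k) (tab ℏ C L S) =
      ∑ v ∈ rowSet n k.1, fCoeff ℏ S v • tab ℏ C L (S - delta v) := by
  simp only [gtOp_tab hS, stepCoeff, Bool.false_eq_true, if_false, shift_unitShift_false]

/-- The formulas prescribe `q ^ h` only for `h = ε_k`. The action of `q ^ (-ε_k)` follows by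
inversion, and this suffices for `q ^ (±α_i)`. -/
theorem Realizable.gtRelations {C : Set (PosRel n)} (hC : Realizable ℏ C) {L : Tableau n}
    (hL : Satisfies ℏ C L) : GTRelations ℏ C L := by
  obtain ⟨-, ρ, hρ⟩ := hC L hL
  have he : ∀ k, ρ (gen ℏ (.e k)) = gtOp ℏ C L (true, k) := fun k =>
    V_hom_ext fun S hS => by rw [(hρ S hS).2.1 k, gtOp_tab_true hS]
  have hf : ∀ k, ρ (gen ℏ (.f k)) = gtOp ℏ C L (false, k) := fun k =>
    V_hom_ext fun S hS => by rw [(hρ S hS).2.2 k, gtOp_tab_false hS]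
  have hrel : ∀ {a b}, UqRel n ℏ a b →
      ρ (RingQuot.mkAlgHom ℂ (UqRel n ℏ) a) = ρ (RingQuot.mkAlgHom ℂ (UqRel n ℏ) b) :=
    fun h => congrArg ρ (RingQuot.mkAlgHom_rel ℂ h)
  simp only [gen] at he hf hρ
  have hK0 := hrel (UqRel.K_zero (n := n) (ℏ := ℏ))
  have hKadd := fun h h' => hrel (UqRel.K_add (n := n) (ℏ := ℏ) h h')
  simp only [map_mul, map_one] at hK0 hKadd
  have hKneg : ∀ S ∈ basisSet ℏ C L, ∀ k : Idx n,
      ρ (RingQuot.mkAlgHom ℂ (UqRel n ℏ) (fK (-eps k))) (tab ℏ C L S) =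
        qpow ℏ (-weight S k) • tab ℏ C L S := by
    intro S hS k
    have h1 := hKadd (-eps k) (eps k)
    rw [neg_add_cancel, hK0] at h1
    have h2 := LinearMap.congr_fun h1 (tab ℏ C L S)
    rw [Module.End.mul_apply, (hρ S hS).1 k, map_smul, Module.End.one_apply] at h2
    have h3 := congrArg (fun y => qpow ℏ (-weight S k) • y) h2
    simp only [smul_smul] at h3
    rwa [mul_comm, qpow_mul_neg, one_smul] at h3
  refine ⟨fun i S hS => ?_, fun i j hij S hS => ?_, fun b i j hij S hS => ?_,
    fun b i j hij S hS => ?_⟩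
  · have h := hrel (UqRel.e_f_same (ℏ := ℏ) i)
    simp only [map_sub, map_mul, map_smul, he, hf] at h
    rw [evalWords_commWords, h, simpleRoot, neg_sub, sub_eq_add_neg (eps i.fst), ← hKadd,
      sub_eq_add_neg (eps i.snd), ← hKadd]
    simp only [LinearMap.smul_apply, LinearMap.sub_apply, Module.End.mul_apply, hKneg S hS,
      (hρ S hS).1, map_smul, smul_smul, ← sub_smul, cartanValue, qnum, ← qpow_add]
    congr 1
    rw [div_eq_inv_mul]
    congr 3 <;> ring
  · have h := hrel (UqRel.e_f_ne (ℏ := ℏ) i j hij)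
    simp only [map_sub, map_mul, map_zero, he, hf] at h
    rw [evalWords_commWords, h, zero_smul, LinearMap.zero_apply]
  · rw [evalWords_serreWords, zero_smul]
    cases b
    · have h := hrel (UqRel.serre_f (ℏ := ℏ) i j hij)
      simp only [map_sub, map_add, map_mul, map_smul, map_pow, map_zero, hf] at h
      rw [h, LinearMap.zero_apply]
    · have h := hrel (UqRel.serre_e (ℏ := ℏ) i j hij)
      simp only [map_sub, map_add, map_mul, map_smul, map_pow, map_zero, he] at h
      rw [h, LinearMap.zero_apply]
  · rw [evalWords_commWords, zero_smul]
    cases b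
    · have h := hrel (UqRel.comm_f (ℏ := ℏ) i j hij)
      simp only [map_mul, hf] at h
      rw [h, sub_self, LinearMap.zero_apply]
    · have h := hrel (UqRel.comm_e (ℏ := ℏ) i j hij)
      simp only [map_mul, he] at h
      rw [h, sub_self, LinearMap.zero_apply]

/-- The exponent of the eigenvalue of `q ^ h` on `T(S)`. -/
def cartanWeight (h : Cartan n) (S : Tableau n) : ℂ := ∑ k, h k * weight S k

theorem cartanWeight_add (h h' : Cartan n) (S : Tableau n) :
    cartanWeight (h + h') S = cartanWeight h S + cartanWeight h' S := by
  simp [cartanWeight, add_mul, Finset.sum_add_distrib]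

theorem cartanWeight_neg (h : Cartan n) (S : Tableau n) :
    cartanWeight (-h) S = -cartanWeight h S := by
  simp [cartanWeight]

theorem cartanWeight_eps (k : Idx n) (S : Tableau n) : cartanWeight (eps k) S = weight S k := by
  classical
  simp only [cartanWeight, eps, Pi.single_apply, ite_mul, one_mul, zero_mul,
    Finset.sum_ite_eq', Finset.mem_univ, if_true]

theorem cartanWeight_simpleRoot (i : SimpleIdx n) (S : Tableau n) :
    cartanWeight (simpleRoot i) S = weight S i.fst - weight S i.snd := by
  rw [simpleRoot, sub_eq_add_neg, cartanWeight_add, cartanWeight_neg, cartanWeight_eps,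
    cartanWeight_eps, sub_eq_add_neg]

theorem sum_shift_unitShift (S : Tableau n) (b : Bool) (v : Pos n) (k : ℕ) :
    ∑ u ∈ rowSet n k, shift S (unitShift b v) u =
      ∑ u ∈ rowSet n k, S u + if v.row = k then (if b then 1 else -1) else 0 := by
  classical
  simp only [shift, Finset.sum_add_distrib, unitShift, Pi.single_apply, add_right_inj]
  by_cases h : v.row = k
  · have hv : v ∈ rowSet n k := by simpa [rowSet] using h
    rw [if_pos h, Finset.sum_eq_single_of_mem v hv fun u _ hu => by simp [hu]]
    cases b <;> simp
  · rw [if_neg h]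
    refine Finset.sum_eq_zero fun u hu => ?_
    rw [if_neg, Int.cast_zero]
    rintro rfl
    rw [rowSet, Finset.mem_filter] at hu
    exact h hu.2

theorem cartanWeight_shift (h : Cartan n) (S : Tableau n) (b : Bool) (i : SimpleIdx n) {v : Pos n}
    (hv : v ∈ rowSet n i.1) : cartanWeight h (shift S (unitShift b v)) =
      cartanWeight h S + (if b then 1 else -1) * pairing h i := by
  classical
  have hvi : v.row = i.1 := by
    rw [rowSet, Finset.mem_filter] at hv
    exact hv.2
  have hw : ∀ k : Idx n, weight (shift S (unitShift b v)) k = weight S k +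
      (if b then 1 else -1) * ((if k = i.fst then 1 else 0) - if k = i.snd then 1 else 0) := by
    intro k
    have h1 : v.row = k.1 ↔ k = i.fst := by
      rw [hvi, Subtype.ext_iff]
      exact eq_comm
    -- The subtraction is not truncated, since `k ≥ 1`.
    have h2 : v.row = k.1 - 1 ↔ k = i.snd := by
      have := (Finset.mem_Icc.1 k.2).1
      rw [hvi, Subtype.ext_iff]
      change i.1 = k.1 - 1 ↔ k.1 = i.1 + 1
      omega
    simp only [weight, sum_shift_unitShift, h1, h2]
    split_ifs <;> ring
  simp only [cartanWeight, hw, mul_add, Finset.sum_add_distrib, pairing, add_right_inj]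
  have : ∀ k : Idx n, h k * ((if b then 1 else -1) * ((if k = i.fst then 1 else 0) -
      if k = i.snd then 1 else 0)) = (if b then 1 else -1) *
        ((if k = i.fst then h k else 0) - if k = i.snd then h k else 0) := fun k => by
    split_ifs <;> ring
  simp only [this, ← Finset.mul_sum, Finset.sum_sub_distrib, Finset.sum_ite_eq',
    Finset.mem_univ, if_true]

/-- The operator of `q ^ h` on `V_C(T(L))`. -/
def cartanOp (ℏ : ℂ) (C : Set (PosRel n)) (L : Tableau n) (h : Cartan n) :
    Module.End ℂ (V ℏ C L) :=
  Finsupp.linearCombination ℂ fun s : basisSet ℏ C L =>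
    qpow ℏ (cartanWeight h s.1) • Finsupp.single s (1 : ℂ)

theorem cartanOp_tab (C : Set (PosRel n)) (L S : Tableau n) (h : Cartan n) :
    cartanOp ℏ C L h (tab ℏ C L S) = qpow ℏ (cartanWeight h S) • tab ℏ C L S := by
  by_cases hS : S ∈ basisSet ℏ C L
  · rw [tab_of_mem hS, cartanOp, Finsupp.linearCombination_single, one_smul]
  · simp [tab, hS]

theorem cartanOp_gtOp (C : Set (PosRel n)) (L : Tableau n) (h : Cartan n) (l : Letter n) :
    cartanOp ℏ C L h * gtOp ℏ C L l * cartanOp ℏ C L (-h) =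
      qpow ℏ ((if l.1 then 1 else -1) * pairing h l.2) • gtOp ℏ C L l := by
  refine V_hom_ext fun S hS => ?_
  rw [Module.End.mul_apply, Module.End.mul_apply, cartanOp_tab, map_smul, map_smul,
    LinearMap.smul_apply, gtOp_tab hS, map_sum, Finset.smul_sum, Finset.smul_sum]
  refine Finset.sum_congr rfl fun v hv => ?_
  rw [map_smul, cartanOp_tab, cartanWeight_shift h S l.1 l.2 hv, cartanWeight_neg, smul_smul,
    smul_smul, smul_smul, qpow_add]
  congr 1
  linear_combination (qpow ℏ ((if l.1 then 1 else -1) * pairing h l.2) *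
    stepCoeff ℏ l.1 S v) * qpow_mul_neg ℏ (cartanWeight h S)

/-- Let `q ^ h` act by the exponent `∑ h_k a_k`. A step in row `i` changes only `a_i` and `a_{i+1}`,
in opposite directions, so all relations between `q ^ h` and the other generators hold for every
`C`. -/
theorem realizable_of_gtRelations {C : Set (PosRel n)}
    (hd : ∀ L : Tableau n, Satisfies ℏ C L → ∀ v : Pos n, v.row < n → gtDenom ℏ L v ≠ 0)
    (hrel : ∀ L : Tableau n, Satisfies ℏ C L → GTRelations ℏ C L) : Realizable ℏ C := by
  intro L hL
  refine ⟨fun S hS => hd S hS.1, ?_⟩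
  have R := hrel L hL
  let g : UqGen n → Module.End ℂ (V ℏ C L)
    | .e i => gtOp ℏ C L (true, i)
    | .f i => gtOp ℏ C L (false, i)
    | .K h => cartanOp ℏ C L h
  have hg : ∀ ⦃a b⦄, UqRel n ℏ a b → FreeAlgebra.lift ℂ g a = FreeAlgebra.lift ℂ g b := by
    intro a b hab
    cases hab with
    | K_zero =>
      simp only [FreeAlgebra.lift_ι_apply, map_one, g]
      refine V_hom_ext fun S _ => ?_
      rw [cartanOp_tab]
      simp [cartanWeight, qpow_zero]
    | K_add h h' =>
      simp only [FreeAlgebra.lift_ι_apply, map_mul, g]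
      refine V_hom_ext fun S _ => ?_
      rw [Module.End.mul_apply, cartanOp_tab, map_smul, cartanOp_tab, cartanOp_tab, smul_smul,
        cartanWeight_add, qpow_add, mul_comm]
    | K_e h i =>
      simp only [FreeAlgebra.lift_ι_apply, map_mul, map_smul, g]
      simpa using cartanOp_gtOp C L h (true, i)
    | K_f h i =>
      simp only [FreeAlgebra.lift_ι_apply, map_mul, map_smul, g]
      simpa using cartanOp_gtOp C L h (false, i)
    | e_f_same i =>
      simp only [FreeAlgebra.lift_ι_apply, map_mul, map_smul, map_sub, g]
      refine V_hom_ext fun S hS => ?_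
      rw [← evalWords_commWords (gtOp ℏ C L), R.e_f_same i S hS, LinearMap.smul_apply,
        LinearMap.sub_apply, cartanOp_tab, cartanOp_tab, cartanWeight_neg,
        cartanWeight_simpleRoot, ← sub_smul, smul_smul, cartanValue, qnum, div_eq_inv_mul]
    | e_f_ne i j hij =>
      simp only [FreeAlgebra.lift_ι_apply, map_mul, map_sub, map_zero, g]
      refine V_hom_ext fun S hS => ?_
      rw [← evalWords_commWords (gtOp ℏ C L), R.e_f_ne i j hij S hS, zero_smul,
        LinearMap.zero_apply]
    | serre_e i j hij =>
      simp only [FreeAlgebra.lift_ι_apply, map_mul, map_sub, map_add, map_smul, map_pow, map_zero, g]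
      refine V_hom_ext fun S hS => ?_
      rw [← evalWords_serreWords (gtOp ℏ C L), R.serre true i j hij S hS, zero_smul,
        LinearMap.zero_apply]
    | serre_f i j hij =>
      simp only [FreeAlgebra.lift_ι_apply, map_mul, map_sub, map_add, map_smul, map_pow, map_zero, g]
      refine V_hom_ext fun S hS => ?_
      rw [← evalWords_serreWords (gtOp ℏ C L), R.serre false i j hij S hS, zero_smul,
        LinearMap.zero_apply]
    | comm_e i j hij =>
      simp only [FreeAlgebra.lift_ι_apply, map_mul, g]
      rw [← sub_eq_zero]
      refine V_hom_ext fun S hS => ?_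
      rw [← evalWords_commWords (gtOp ℏ C L), R.comm true i j hij S hS, zero_smul,
        LinearMap.zero_apply]
    | comm_f i j hij =>
      simp only [FreeAlgebra.lift_ι_apply, map_mul, g]
      rw [← sub_eq_zero]
      refine V_hom_ext fun S hS => ?_
      rw [← evalWords_commWords (gtOp ℏ C L), R.comm false i j hij S hS, zero_smul,
        LinearMap.zero_apply]
  refine ⟨RingQuot.liftAlgHom ℂ ⟨FreeAlgebra.lift ℂ g, hg⟩, fun S hS => ⟨fun k => ?_, fun k => ?_,
    fun k => ?_⟩⟩
  · simp only [gen, RingQuot.liftAlgHom_mkAlgHom_apply, FreeAlgebra.lift_ι_apply, g]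
    rw [cartanOp_tab, cartanWeight_eps]
  · simp only [gen, RingQuot.liftAlgHom_mkAlgHom_apply, FreeAlgebra.lift_ι_apply, g]
    exact gtOp_tab_true hS k
  · simp only [gen, RingQuot.liftAlgHom_mkAlgHom_apply, FreeAlgebra.lift_ι_apply, g]
    exact gtOp_tab_false hS k

end Realizability

/-! ### Removal of relations -/

section Removal

variable {n : ℕ} {ℏ : ℂ}

theorem QExponent.weight {ι : Type} {S : (ι → ℂ) → Tableau n}
    (hS : ∀ v, QExponent ℏ fun t => S t v) (k : Idx n) :
    QExponent ℏ fun t => QuantumGT.weight (S t) k :=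
  ((QExponent.sum _ fun u _ => hS u).sub (QExponent.sum _ fun u _ => hS u)).add
    (QExponent.const _)

variable {C₁ C₂ : Set (PosRel n)} {w : Pos n}

/-- A vanishing factor puts two entries of a row in one class, so they are `C₂`-connected and keep
their difference under deformation. The factor would then vanish at a `C₁`-realization. -/
theorem gtDenom_ne_zero_of_removal (hℏ : ℏ ≠ 0) (hq : ∀ m : ℤ, qpow ℏ m = 1 → m = 0)
    (hreal : Realizable ℏ C₁) (hC₂ : C₂ = {r ∈ C₁ | ¬ r.Involves w})
    (hw : (∀ r ∈ C₁, r.Involves w → r.left = w ∧ r.right ≠ w) ∨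
      (∀ r ∈ C₁, r.Involves w → r.left ≠ w ∧ r.right = w))
    {S : Tableau n} (hS : Satisfies ℏ C₂ S) {v : Pos n} (hv : v.row < n) :
    gtDenom ℏ S v ≠ 0 := by
  obtain ⟨T, hT, hTS⟩ := exists_deform hℏ hq hC₂ hw hS 0
  choose t ht using fun p => ((hT p).nonempty).of_image
  have hmem := (hTS t ht 0 (by simp)).2 (by rw [shift_zero]; exact self_mem_basisSet hS)
  rw [shift_zero] at hmem
  have hne := (hreal _ hmem.1).1 _ hmem v hv
  rw [gtDenom, Finset.prod_ne_zero_iff] at hne ⊢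
  intro u hu h0
  obtain ⟨huv, hur⟩ := Finset.mem_erase.1 hu
  have hrow : u.row = v.row := by
    rw [rowSet, Finset.mem_filter] at hur
    exact hur.2
  have hconn := (satisfies_iff.1 hS).2 u v hrow huv (mem_qLattice_of_qnum_eq_zero hq h0)
  refine hne u hu ?_
  rw [deform_sub (by rw [hC₂]; exact Set.sep_subset _ _) w S t hconn, h0]

/-- The continuation argument, for any relation `M = κ` with `κ` rational in the `q ^ t_p`. It
serves all defining relations among the `e_k` and `f_k`. -/
theorem evalWords_of_removal (hℏ : ℏ ≠ 0) (hq : ∀ m : ℤ, qpow ℏ m = 1 → m = 0)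
    (hreal : Realizable ℏ C₁) (hC₂ : C₂ = {r ∈ C₁ | ¬ r.Involves w})
    (hw : (∀ r ∈ C₁, r.Involves w → r.left = w ∧ r.right ≠ w) ∨
      (∀ r ∈ C₁, r.Involves w → r.left ≠ w ∧ r.right = w))
    (M : List (ℂ × List (Letter n))) (κ : Tableau n → ℂ)
    (hκ : ∀ (G : Set (Pos n → ℂ)) (S : (Pos n → ℂ) → Tableau n),
      (∀ v, QExponent ℏ fun t => S t v) → QRational ℏ G fun t => κ (S t))
    (hM : ∀ S, Satisfies ℏ C₁ S →
      evalWords (gtOp ℏ C₁ S) M (tab ℏ C₁ S S) = κ S • tab ℏ C₁ S S)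
    {L S : Tableau n} (hS : S ∈ basisSet ℏ C₂ L) :
    evalWords (gtOp ℏ C₂ L) M (tab ℏ C₂ L S) = κ S • tab ℏ C₂ L S := by
  rw [evalWords_gtOp_iff hS, basisSet_eq hS]
  obtain ⟨N, hN⟩ : ∃ N : ℕ, ∀ p ∈ M, p.2.length ≤ N :=
    ⟨(M.map fun p => p.2.length).sum, fun p hp =>
      List.single_le_sum (fun _ _ => Nat.zero_le _) _ (List.mem_map_of_mem hp)⟩
  obtain ⟨T, hT, hTS⟩ := exists_deform hℏ hq hC₂ hw hS.1 N
  -- Truncation to the ball gives one predicate valid for `S` and for all its deformations; outside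
  -- the ball their basis sets may differ.
  let P : (Pos n → ℤ) → Prop := fun z => shift S z ∈ basisSet ℏ C₂ S ∧ ∀ v, |z v| ≤ N
  have hP : ∀ z : Pos n → ℤ, (∀ v, |z v| ≤ N) → (shift S z ∈ basisSet ℏ C₂ S ↔ P z) :=
    fun z hz => ⟨fun h => ⟨h, hz⟩, fun h => h.1⟩
  rw [evalWords_localOp_congr S hP M hN]
  have hsat : ∀ t : Pos n → ℂ, (∀ p, t p ∈ T p) → Satisfies ℏ C₁ (deform C₁ C₂ w S t) := by
    intro t ht
    have h := (hTS t ht 0 (by simp)).2 (by rw [shift_zero]; exact self_mem_basisSet hS.1)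
    rw [shift_zero] at h
    exact h.1
  -- The identity is known on the product of the `T p` and wanted at `0`; denominators have to be
  -- controlled only on these two sets.
  let G : Set (Pos n → ℂ) := {t | t = 0 ∨ ∀ p, t p ∈ T p}
  have hdenom : ∀ t ∈ G, ∀ z, P z → ∀ v : Pos n, v.row < n →
      gtDenom ℏ (shift (deform C₁ C₂ w S t) z) v ≠ 0 := by
    rintro t (rfl | ht) z hz v hv
    · rw [deform_zero]
      exact gtDenom_ne_zero_of_removal hℏ hq hreal hC₂ hw hz.1.1 hv
    · exact (hreal _ (hsat t ht)).1 _ ((hTS t ht z hz.2).2 hz.1) v hv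
  funext z
  have hrat : QRational ℏ G fun t =>
      evalWords (localOp ℏ (deform C₁ C₂ w S t) P) M (Pi.single 0 1) z -
        κ (deform C₁ C₂ w S t) * (Pi.single 0 1 : (Pos n → ℤ) → ℂ) z :=
    (QRational.evalWords (deform_qExponent C₁ C₂ w S) hdenom M z).sub
      ((hκ G _ (deform_qExponent C₁ C₂ w S)).mul (QRational.const _))
  have hzero := hrat.eq_zero T hT (fun t ht => .inr ht) (fun t ht => ?_) (t := 0) (.inl rfl)
  · rw [deform_zero] at hzero
    exact sub_eq_zero.1 hzero
  · have h1 := (evalWords_gtOp_iff (self_mem_basisSet (hsat t ht)) M _).1 (hM _ (hsat t ht))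
    rw [evalWords_localOp_congr _
      (fun z hz => (hTS t ht z hz).trans (hP z hz)) M hN] at h1
    rw [h1, Pi.smul_apply, smul_eq_mul, sub_self]

/-- A removal preserves realizability. -/
theorem Realizable.of_rrStep (hℏ : ℏ ≠ 0) (hq : ∀ m : ℤ, qpow ℏ m = 1 → m = 0)
    (hC₁ : C₁ ⊆ allRel n) (hreal : Realizable ℏ C₁) (h : RRStep ℏ C₁ C₂) : Realizable ℏ C₂ := by
  obtain ⟨w, -, L₀, hL₀, hinf, hC₂⟩ := h
  have hw := one_sided_of_infinite hq hC₁ hL₀ hinf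
  refine realizable_of_gtRelations
    (fun L hL v hv => gtDenom_ne_zero_of_removal hℏ hq hreal hC₂ hw hL hv) fun L hL => ?_
  have hzero : ∀ (G : Set (Pos n → ℂ)) (S : (Pos n → ℂ) → Tableau n),
      (∀ v, QExponent ℏ fun t => S t v) → QRational ℏ G fun _ => 0 :=
    fun _ _ _ => QRational.const 0
  have hR : ∀ S, Satisfies ℏ C₁ S → GTRelations ℏ C₁ S := fun S hS => hreal.gtRelations hS
  exact
    -- Only this relation has a nonzero scalar; the others use `κ = 0`.
    { e_f_same := fun i S hS => evalWords_of_removal hℏ hq hreal hC₂ hw _ (cartanValue ℏ i)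
        (fun G S hS => QRational.qnum ((QExponent.weight hS _).sub (QExponent.weight hS _)))
        (fun S hS => (hR S hS).e_f_same i S (self_mem_basisSet hS)) hS
      e_f_ne := fun i j hij S hS => evalWords_of_removal hℏ hq hreal hC₂ hw _ (fun _ => 0) hzero
        (fun S hS => (hR S hS).e_f_ne i j hij S (self_mem_basisSet hS)) hS
      serre := fun b i j hij S hS => evalWords_of_removal hℏ hq hreal hC₂ hw _ (fun _ => 0) hzero
        (fun S hS => (hR S hS).serre b i j hij S (self_mem_basisSet hS)) hS
      comm := fun b i j hij S hS => evalWords_of_removal hℏ hq hreal hC₂ hw _ (fun _ => 0) hzero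
        (fun S hS => (hR S hS).comm b i j hij S (self_mem_basisSet hS)) hS }

theorem RRStep.subset (h : RRStep ℏ C₁ C₂) : C₂ ⊆ C₁ := by
  obtain ⟨w, -, -, -, -, rfl⟩ := h
  exact Set.sep_subset _ _

end Removal

end QuantumGT

end

theorem theorem3p11 (n : ℕ) (hn : 2 ≤ n) (q ℏ : ℂ) (hℏ : Complex.exp ℏ = q)
    (hq : ∀ m : ℕ, 0 < m → q ^ m ≠ 1) (C₁ C₂ : Set (QuantumGT.PosRel n))
    (hC₁ : C₁ ⊆ QuantumGT.allRel n) (hreal : QuantumGT.Realizable ℏ C₁)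
    (hRR : QuantumGT.ObtainedByRR ℏ C₁ C₂) :
    QuantumGT.Realizable ℏ C₂ := by
  have hℏ0 : ℏ ≠ 0 := by
    rintro rfl
    exact hq 1 one_pos (by rw [← hℏ, Complex.exp_zero, one_pow])
  have hnat : ∀ m : ℕ, QuantumGT.qpow ℏ m = q ^ m := fun m => by
    rw [QuantumGT.qpow, ← hℏ, ← Complex.exp_nat_mul, mul_comm]
  have hint : ∀ m : ℤ, QuantumGT.qpow ℏ m = 1 → m = 0 := by
    intro m hm
    by_contra hm0
    have hpos : 0 < m.natAbs := Int.natAbs_pos.2 hm0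
    refine hq m.natAbs hpos ?_
    rw [← hnat]
    rcases Int.natAbs_eq m with h | h
    · rw [h] at hm
      simpa using hm
    · rw [h] at hm
      have := QuantumGT.qpow_mul_neg ℏ (m.natAbs : ℂ)
      rw [Int.cast_neg, Int.cast_natCast] at hm
      rwa [hm, mul_one] at this
  -- The inclusion in `allRel` is carried along because each removal uses that no relation has equal
  -- sides.
  have key : C₂ ⊆ QuantumGT.allRel n ∧ QuantumGT.Realizable ℏ C₂ := by
    induction hRR with
    | single h => exact ⟨h.subset.trans hC₁, hreal.of_rrStep hℏ0 hint hC₁ h⟩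
    | tail _ h ih => exact ⟨h.subset.trans ih.1, ih.2.of_rrStep hℏ0 hint ih.1 h⟩
  exact key.2
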